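/- For a field $K$ and a finite group $G$, let $G$ act on the rational function field $K(x(g):g\in G)$ by the $K$-automorphisms with $h\cdot x(g)=x(hg)$, and let $K(G)=K(x(g):g\in G)^G$ be the fixed field. A field extension $L/F$ is called rational if $L$ is $F$-isomorphic to a rational function field $F(x_1,\dots,x_n)$ for some $n\ge 0$; stably rational if $L(y_1,\dots,y_m)$ is rational over $F$ for some $m\ge 0$; retract rational if $L$ is the quotient field of a finitely generated $F$-subalgebra $A\subseteq L$ for which there are $n\ge 0$, a nonzero $f\in F[x_1,\dots,x_n]$ and $F$-algebra homomorphisms $i:A\to F[x_1,\dots,x_n][1/f]$ and $r:F[x_1,\dots,x_n][1/f]\to A$ with $r\circ i=\mathrm{id}_A$. Theorem 1.9. Let $K$ be any field and let $H$ and $G$ be finite groups. There is a $K$-embedding of $K(G)$ into $K(H\times G)$ such that, if $K(H)$ is rational (resp. stably rational, retract rational) over $K$, then $K(H\times G)$, regarded as an extension of $K(G)$ through this embedding, is rational (resp. stably rational, retract rational) over $K(G)$. In particular, if both $K(H)$ and $K(G)$ are rational (resp. stably rational, retract rational) over $K$, then so is $K(H\times G)$ over $K$. -/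

import Mathlib

noncomputable section

/-- The rational function field `K(x(i) : i ∈ σ)`. -/
abbrev RatFunField (K σ : Type*) [Field K] : Type _ := FractionRing (MvPolynomial σ K)

/-- The variable `x(i)` of the rational function field `K(x(i) : i ∈ σ)`. -/
def RatFunField.x (K : Type*) [Field K] {σ : Type*} (i : σ) : RatFunField K σ :=
  algebraMap (MvPolynomial σ K) (RatFunField K σ) (MvPolynomial.X i)

/-- The action of the group `G` on the rational function field `K(x(g) : g ∈ G)` by
`K`-automorphisms, given on the variables by `h · x(g) = x(hg)`. -/
def regularAction (K G : Type*) [Field K] [Group G] :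
    G →* (RatFunField K G ≃ₐ[K] RatFunField K G) :=
  (IsFractionRing.fieldEquivOfAlgEquivHom K (RatFunField K G)).comp
    { toFun := fun h => MvPolynomial.renameEquiv K (Equiv.mulLeft h)
      map_one' := by
        ext p
        simp
      map_mul' := fun a b => by
        ext p
        simp [MvPolynomial.rename_rename, Function.comp_def] }

theorem regularAction_x (K : Type*) {G : Type*} [Field K] [Group G] (h g : G) :
    regularAction K G h (RatFunField.x K g) = RatFunField.x K (h * g) := by
  simp [regularAction, RatFunField.x]

/-- The field `K(G) = K(x(g) : g ∈ G)^G` of rational functions that are fixed by all of `G`. -/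
abbrev NoetherField (K G : Type*) [Field K] [Group G] : IntermediateField K (RatFunField K G) :=
  IntermediateField.fixedField (regularAction K G).range

/-- The field extension `L` of `K` is rational: it is `K`-isomorphic to a rational function
field in finitely many (possibly zero) variables over `K`. -/
def IsRationalExt (K L : Type*) [Field K] [Field L] [Algebra K L] : Prop :=
  ∃ n : ℕ, Nonempty (L ≃ₐ[K] RatFunField K (Fin n))

/-- The field extension `L` of `K` is stably rational: for some `m`, the rational function
field `L(y₁, …, yₘ)` is rational over `K`. -/
def IsStablyRationalExt (K L : Type*) [Field K] [Field L] [Algebra K L] : Prop :=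
  ∃ m : ℕ, IsRationalExt K (RatFunField L (Fin m))

/-- The field extension `L` of `K` is retract rational: it is the field of fractions of a
finitely generated `K`-subalgebra `A` that is a retract of a localized polynomial ring
`K[x₁, …, xₙ][1/f]` with `f ≠ 0`, that is, there are `K`-algebra homomorphisms
`i : A → K[x₁, …, xₙ][1/f]` and `r : K[x₁, …, xₙ][1/f] → A` with `r ∘ i = id`. -/
def IsRetractRationalExt (K L : Type*) [Field K] [Field L] [Algebra K L] : Prop :=
  ∃ A : Subalgebra K L, A.FG ∧ IsFractionRing A L ∧
    ∃ (n : ℕ) (f : MvPolynomial (Fin n) K), f ≠ 0 ∧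
      ∃ (i : A →ₐ[K] Localization.Away f) (r : Localization.Away f →ₐ[K] A),
        r.comp i = AlgHom.id K A

end

noncomputable section

/-! Let M = K(x(h,g)). The sums of variables over the fibres of the two projections embed K(x(h))
and K(x(g)) equivariantly in M, with the same image s for the sum of all variables. Let P be the
field of the quotients x(h)/s and L = P^H. Averaging against an element of P of trace one gives K(H)
= L(s), purely transcendental in s (`isPureBasis_varSum`).

Let E be the compositum in M of P and K(x(g)). Modulo row and column sums, 1 and the x(h,g) span
over E a space of dimension at most (|H|-1)(|G|-1)+1. As H × G acts faithfully on E, Lagrange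
interpolation shows that invariants span all the x(h,g). Hence M = E(Z) with Z a set of at most
(|H|-1)(|G|-1) invariants, and counting transcendence degrees makes the x(g), the x(h)/s with h ≠ 1,
and Z a transcendence basis that generates M (`exists_isPureBasis_invariants`). A second averaging
argument gives that K(H × G) is generated by L, K(G) and Z (`noetherField_prod_le_adjoin`).

So K(H × G) arises over F = K(G) from L by adjoining the independent elements of Z. If Z is
nonempty, some z in Z takes the place of s, and a basis of K(H) = L(s) over K becomes part of a
basis over F. Stable and retract rationality need no such z: K(H) = L(s) makes L stably rational
whenever K(H) is, and retractions of K(H) base change when written as specializations at a point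
(`SpecializesTo`). In the rational case Z is empty only for trivial H or G. For trivial H the
embedding is an isomorphism. For trivial G, K(G) is a rational function field in one variable, which
can be sent to a member of a basis of K(H). The last claims follow by transitivity. -/

/-- A family `b` in `L` that is algebraically independent over `K` and generates `L` as a field
extension of `K`. -/
def IsPureBasis (K : Type*) {L ι : Type*} [Field K] [Field L] [Algebra K L] (b : ι → L) : Prop :=
  AlgebraicIndependent K b ∧ IntermediateField.adjoin K (Set.range b) = ⊤

/-! ### Purely transcendental bases and counting of transcendence degrees -/

section PureBasis

variable {K L M ι κ : Type*} [Field K] [Field L] [Field M] [Algebra K L] [Algebra K M]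

theorem RatFunField.isPureBasis_x (K ι : Type*) [Field K] :
    IsPureBasis K (RatFunField.x K : ι → RatFunField K ι) := by
  refine ⟨?_, ?_⟩
  · exact (MvPolynomial.algebraicIndependent_X ι K).map'
      (f := IsScalarTower.toAlgHom K (MvPolynomial ι K) (RatFunField K ι))
      (IsFractionRing.injective _ _)
  · rw [eq_top_iff]
    rintro a -
    obtain ⟨p, q, -, rfl⟩ := IsFractionRing.div_surjective (A := MvPolynomial ι K) a
    have key : ∀ p : MvPolynomial ι K, algebraMap _ (RatFunField K ι) p ∈
        IntermediateField.adjoin K (Set.range (RatFunField.x K : ι → RatFunField K ι)) := by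
      intro p
      induction p using MvPolynomial.induction_on with
      | C a => exact IntermediateField.algebraMap_mem _ a
      | add p q hp hq => rw [map_add]; exact add_mem hp hq
      | mul_X p i hp =>
        rw [map_mul]
        exact mul_mem hp (IntermediateField.subset_adjoin _ _ ⟨i, rfl⟩)
    exact div_mem (key p) (key q)

/-- An algebraically independent family can be mapped to any other one with the same index set. -/
theorem AlgebraicIndependent.exists_adjoin_algHom {x : ι → L} {y : ι → M}
    (hx : AlgebraicIndependent K x) (hy : AlgebraicIndependent K y) :
    ∃ f : IntermediateField.adjoin K (Set.range x) →ₐ[K] M,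
      ∀ i, f ⟨x i, IntermediateField.subset_adjoin _ _ ⟨i, rfl⟩⟩ = y i := by
  refine ⟨(IsFractionRing.liftAlgHom (K := FractionRing (MvPolynomial ι K))
    (algebraicIndependent_iff_injective_aeval.1 hy)).comp hx.reprField, fun i => ?_⟩
  have : hx.reprField ⟨x i, IntermediateField.subset_adjoin _ _ ⟨i, rfl⟩⟩ =
      algebraMap (MvPolynomial ι K) _ (MvPolynomial.X i) := by
    refine hx.aevalEquivField.symm_apply_eq.2 (Subtype.ext ?_)
    rw [hx.aevalEquivField_algebraMap_apply_coe, MvPolynomial.aeval_X]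
  simp [this]

theorem IsPureBasis.exists_algHom {x : ι → L} {y : ι → M}
    (hx : IsPureBasis K x) (hy : AlgebraicIndependent K y) :
    ∃ f : L →ₐ[K] M, ∀ i, f (x i) = y i := by
  obtain ⟨f, hf⟩ := hx.1.exists_adjoin_algHom hy
  refine ⟨f.comp ((IntermediateField.equivOfEq hx.2).symm.toAlgHom.comp
    IntermediateField.topEquiv.symm.toAlgHom), fun i => ?_⟩
  exact (congrArg f (Subtype.ext rfl)).trans (hf i)

theorem IntermediateField.map_mem_adjoin_of_adjoin_eq_top {S : Set L}
    (hS : IntermediateField.adjoin K S = ⊤) (f : L →ₐ[K] M) (E : IntermediateField K M)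
    (h : ∀ a ∈ S, f a ∈ E) (a : L) : f a ∈ E := by
  have : IntermediateField.adjoin K S ≤ E.comap f := IntermediateField.adjoin_le_iff.2 h
  exact this (hS ▸ IntermediateField.mem_top)

theorem IsPureBasis.nonempty_algEquiv {x : ι → L} (hx : IsPureBasis K x) :
    Nonempty (L ≃ₐ[K] RatFunField K ι) := by
  obtain ⟨f, hf⟩ := (RatFunField.isPureBasis_x K ι).exists_algHom hx.1
  refine ⟨(AlgEquiv.ofBijective f ⟨f.injective, ?_⟩).symm⟩
  rw [← AlgHom.fieldRange_eq_top, eq_top_iff, ← hx.2, IntermediateField.adjoin_le_iff]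
  rintro _ ⟨i, rfl⟩
  exact ⟨_, hf i⟩

theorem IsPureBasis.map_algEquiv {x : ι → L} (hx : IsPureBasis K x) (e : L ≃ₐ[K] M) :
    IsPureBasis K (e ∘ x) := by
  refine ⟨hx.1.map' (f := e.toAlgHom) e.injective, ?_⟩
  rw [eq_top_iff]
  rintro a -
  obtain ⟨a, rfl⟩ := e.surjective a
  exact IntermediateField.map_mem_adjoin_of_adjoin_eq_top hx.2 e.toAlgHom _
    (by rintro _ ⟨i, rfl⟩; exact IntermediateField.subset_adjoin _ _ ⟨i, rfl⟩) a

theorem IsPureBasis.comp_equiv {x : ι → L} (hx : IsPureBasis K x) (e : κ ≃ ι) :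
    IsPureBasis K (x ∘ e) :=
  ⟨hx.1.comp e e.injective, by rw [e.surjective.range_comp]; exact hx.2⟩

theorem isRationalExt_iff : IsRationalExt K L ↔ ∃ (n : ℕ) (b : Fin n → L), IsPureBasis K b := by
  constructor
  · rintro ⟨n, ⟨e⟩⟩
    exact ⟨n, _, (RatFunField.isPureBasis_x K (Fin n)).map_algEquiv e.symm⟩
  · rintro ⟨n, b, hb⟩
    exact ⟨n, hb.nonempty_algEquiv⟩

theorem IsPureBasis.isRationalExt [Finite ι] {x : ι → L} (hx : IsPureBasis K x) :
    IsRationalExt K L :=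
  isRationalExt_iff.2 ⟨_, _, hx.comp_equiv (Finite.equivFin ι).symm⟩

theorem IsPureBasis.isTranscendenceBasis {x : ι → L} (hx : IsPureBasis K x) :
    IsTranscendenceBasis K x := by
  refine hx.1.isTranscendenceBasis_iff_isAlgebraic.2 ?_
  rw [← IntermediateField.isAlgebraic_adjoin_iff_top, hx.2]
  exact ⟨fun a => isAlgebraic_algebraMap (⟨a, trivial⟩ : (⊤ : IntermediateField K L))⟩

theorem IsPureBasis.trdeg_eq [Finite ι] {x : ι → L} (hx : IsPureBasis K x) :
    Algebra.trdeg K L = (Nat.card ι : ℕ) := by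
  have := hx.isTranscendenceBasis.lift_cardinalMk_eq_trdeg
  rw [← Nat.cast_card, Cardinal.lift_natCast] at this
  exact (Cardinal.lift_eq_nat_iff.1 this.symm)

/-- A generating family contains a transcendence basis, so one with at most trdeg many members is
itself such a basis. Independence thus reduces to generation and a count. -/
theorem isPureBasis_of_card_le [Finite ι] {x : ι → L} {n : ℕ} (hn : Algebra.trdeg K L = n)
    (hx : IntermediateField.adjoin K (Set.range x) = ⊤) (hι : Nat.card ι ≤ n) :
    IsPureBasis K x := by
  refine ⟨?_, hx⟩
  have : Algebra.IsAlgebraic (Algebra.adjoin K (Set.range x)) L := by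
    rw [← IntermediateField.isAlgebraic_adjoin_iff_top, hx]
    exact ⟨fun a => isAlgebraic_algebraMap (⟨a, trivial⟩ : (⊤ : IntermediateField K L))⟩
  refine (Algebra.IsAlgebraic.isTranscendenceBasis_of_lift_le_trdeg_of_finite K x ?_).1
  rw [hn, ← Nat.cast_card, Cardinal.lift_natCast, Cardinal.lift_natCast]
  exact_mod_cast hι

theorem trdeg_tower [Algebra L M] [IsScalarTower K L M] {a b : ℕ}
    (ha : Algebra.trdeg K L = a) (hb : Algebra.trdeg L M = b) :
    Algebra.trdeg K M = (a + b : ℕ) := by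
  have := lift_trdeg_add_eq K L M
  rw [ha, hb, Cardinal.lift_natCast, Cardinal.lift_natCast] at this
  rw [← Cardinal.lift_eq_nat_iff, ← this, Nat.cast_add]

theorem trdeg_tower_cancel [Algebra L M] [IsScalarTower K L M] {a b : ℕ}
    (ha : Algebra.trdeg K L = a) (hb : Algebra.trdeg K M = (a + b : ℕ)) :
    Algebra.trdeg L M = b := by
  have := lift_trdeg_add_eq K L M
  rw [ha, hb, Cardinal.lift_natCast, Cardinal.lift_natCast, Nat.cast_add] at this
  exact Cardinal.lift_eq_nat_iff.1 (Cardinal.eq_of_add_eq_add_left this (Cardinal.natCast_lt_aleph0))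

theorem trdeg_tower_cancel' [Algebra L M] [IsScalarTower K L M] {a b : ℕ}
    (hb : Algebra.trdeg L M = b) (ha : Algebra.trdeg K M = (a + b : ℕ)) :
    Algebra.trdeg K L = a := by
  have := lift_trdeg_add_eq K L M
  rw [ha, hb, Cardinal.lift_natCast, Cardinal.lift_natCast, Nat.cast_add] at this
  exact Cardinal.lift_eq_nat_iff.1
    (Cardinal.eq_of_add_eq_add_right this (Cardinal.natCast_lt_aleph0))

theorem IsPureBasis.sumElim_comp [Algebra L M] [IsScalarTower K L M] {x : ι → L} {y : κ → M}
    (hx : IsPureBasis K x) (hy : IsPureBasis L y) :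
    IsPureBasis K (Sum.elim y (algebraMap L M ∘ x)) := by
  refine ⟨hx.1.sumElim_comp hy.1, ?_⟩
  set A := IntermediateField.adjoin K (Set.range (Sum.elim y (algebraMap L M ∘ x)))
  have hL : ∀ a : L, algebraMap L M a ∈ A :=
    IntermediateField.map_mem_adjoin_of_adjoin_eq_top hx.2 (IsScalarTower.toAlgHom K L M) A
      (by rintro _ ⟨i, rfl⟩; exact IntermediateField.subset_adjoin _ _ ⟨Sum.inr i, rfl⟩)
  -- The field generated over `K` contains the image of `L`, so it can be compared with a field
  -- generated over `L`.
  let B : IntermediateField L M := { A.toSubfield with algebraMap_mem' := hL }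
  have : IntermediateField.adjoin L (Set.range y) ≤ B := IntermediateField.adjoin_le_iff.2
    (by rintro _ ⟨i, rfl⟩; exact IntermediateField.subset_adjoin K _ ⟨Sum.inl i, rfl⟩)
  rw [hy.2] at this
  exact eq_top_iff.2 fun a _ => this (IntermediateField.mem_top (x := a))

/-- The coefficientwise embedding of rational function fields. -/
theorem RatFunField.exists_map (K L ι : Type*) [Field K] [Field L] [Algebra K L] :
    ∃ f : RatFunField K ι →ₐ[K] RatFunField L ι, ∀ i, f (RatFunField.x K i) = RatFunField.x L i :=
  (RatFunField.isPureBasis_x K ι).exists_algHom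
    ((RatFunField.isPureBasis_x L ι).1.restrictScalars (algebraMap K L).injective)

end PureBasis

end

noncomputable section

/-! ### Stable rationality -/

section Stably

variable {K L T ι κ : Type*} [Field K] [Field L] [Field T] [Algebra K L] [Algebra L T]
  [Algebra K T] [IsScalarTower K L T]

theorem isStablyRationalExt_of_isPureBasis [Finite ι] [Finite κ] {t : ι → T} {v : κ → T}
    (ht : IsPureBasis L t) (hv : IsPureBasis K v) : IsStablyRationalExt K L := by
  obtain ⟨e⟩ := (ht.comp_equiv (Finite.equivFin ι).symm).nonempty_algEquiv
  exact ⟨_, (hv.map_algEquiv (e.restrictScalars K)).isRationalExt⟩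

omit [Algebra L T] [IsScalarTower K L T] in
theorem IsPureBasis.of_isEmpty_self [IsEmpty ι] (t : ι → L) : IsPureBasis L t := by
  refine ⟨algebraicIndependent_empty_type, ?_⟩
  rw [eq_top_iff]
  exact fun a _ => IntermediateField.algebraMap_mem _ a

theorem IsRationalExt.isStablyRationalExt (h : IsRationalExt K L) : IsStablyRationalExt K L := by
  obtain ⟨n, b, hb⟩ := isRationalExt_iff.1 h
  exact isStablyRationalExt_of_isPureBasis (IsPureBasis.of_isEmpty_self (Fin.elim0 : Fin 0 → L)) hb

/-- If some purely transcendental extension `T` of `N` is generated over `F` by a stably rational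
extension `L` of `K` and by as few further elements as the transcendence degrees allow, then `N`
is stably rational over `F`. -/
theorem IsStablyRationalExt.of_adjoin_eq_top {F N : Type*} [Field F] [Field N] [Algebra K F]
    [Algebra F N] [Algebra N T] [Algebra F T] [IsScalarTower F N T] [IsScalarTower K F T]
    [Finite ι] [Finite κ] {t : ι → T} {v : κ → T} (hL : IsStablyRationalExt K L)
    (ht : IsPureBasis N t)
    (hv : IntermediateField.adjoin F (Set.range (algebraMap L T) ∪ Set.range v) = ⊤)
    {a b : ℕ} (ha : Algebra.trdeg F N = a) (hb : Algebra.trdeg K L = b)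
    (hab : b + Nat.card κ ≤ a + Nat.card ι) : IsStablyRationalExt F N := by
  obtain ⟨m, hm⟩ := hL
  obtain ⟨l, d, hd⟩ := isRationalExt_iff.1 hm
  obtain ⟨f, hf⟩ := RatFunField.exists_map L T (Fin m)
  have hτ := ht.sumElim_comp (RatFunField.isPureBasis_x T (Fin m))
  have hl : l = b + m := by
    have h1 := trdeg_tower hb (RatFunField.isPureBasis_x L (Fin m)).trdeg_eq
    rw [hd.trdeg_eq] at h1
    rw [Nat.card_fin, Nat.card_fin] at h1
    exact_mod_cast h1
  have hdeg : Algebra.trdeg F (RatFunField T (Fin m)) = (a + (m + Nat.card ι) : ℕ) := by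
    have h1 := trdeg_tower ha hτ.trdeg_eq
    rw [Nat.card_sum] at h1
    rwa [Nat.card_fin] at h1
  -- The `m` variables that make `L` rational are adjoined to `T` as well. The basis `d` of `L(y)`
  -- and `v` then generate, and they number b + m + |κ| ≤ a + m + |ι|.
  refine isStablyRationalExt_of_isPureBasis hτ (isPureBasis_of_card_le
    (x := Sum.elim (f ∘ d) (algebraMap T (RatFunField T (Fin m)) ∘ v)) hdeg ?_ ?_)
  · set A := IntermediateField.adjoin F
      (Set.range (Sum.elim (f ∘ d) (algebraMap T (RatFunField T (Fin m)) ∘ v)))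
    have h1 : ∀ u, f u ∈ A := by
      intro u
      have := IntermediateField.map_mem_adjoin_of_adjoin_eq_top hd.2 (f.restrictScalars K)
        (A.restrictScalars K)
        (by rintro _ ⟨i, rfl⟩; exact IntermediateField.subset_adjoin F _ ⟨Sum.inl i, rfl⟩) u
      exact this
    have h2 : ∀ u, algebraMap T (RatFunField T (Fin m)) u ∈ A := by
      refine IntermediateField.map_mem_adjoin_of_adjoin_eq_top hv
        (IsScalarTower.toAlgHom F T (RatFunField T (Fin m))) A ?_
      rintro _ (⟨i, rfl⟩ | ⟨i, rfl⟩)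
      · have := h1 (algebraMap L _ i)
        rw [f.commutes, IsScalarTower.algebraMap_apply L T] at this
        exact this
      · exact IntermediateField.subset_adjoin F _ ⟨Sum.inr i, rfl⟩
    let B : IntermediateField T (RatFunField T (Fin m)) :=
      { A.toSubfield with algebraMap_mem' := h2 }
    have h3 : IntermediateField.adjoin T (Set.range (RatFunField.x T : Fin m → _)) ≤ B := by
      refine IntermediateField.adjoin_le_iff.2 ?_
      rintro _ ⟨i, rfl⟩
      have := h1 (RatFunField.x L i)
      rwa [hf] at this
    rw [(RatFunField.isPureBasis_x T (Fin m)).2] at h3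
    exact eq_top_iff.2 fun u _ => h3 (IntermediateField.mem_top (x := u))
  · rw [Nat.card_sum, Nat.card_fin]
    omega

end Stably

/-! ### Retract rationality as specialization at a point -/

section Retract

open MvPolynomial

variable {K L T ι κ : Type*} [Field K] [Field L] [Field T] [Algebra K L] [Algebra K T]

/-- The element `t` of `T` is a quotient of polynomials in the family `x` whose denominator does
not vanish at `c`, and its value at `c` is `a`. -/
def SpecializesTo (K : Type*) {L T ι : Type*} [Field K] [Field L] [Field T] [Algebra K L]
    [Algebra K T] (x : ι → T) (c : ι → L) (t : T) (a : L) : Prop :=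
  ∃ p q : MvPolynomial ι K, aeval c q ≠ 0 ∧ t * aeval x q = aeval x p ∧ aeval c p = a * aeval c q

namespace SpecializesTo

variable {x : ι → T} {c : ι → L} {t t' : T} {a a' : L}

theorem of_aeval (p : MvPolynomial ι K) : SpecializesTo K x c (aeval x p) (aeval c p) :=
  ⟨p, 1, by simp, by simp, by simp⟩

theorem var (i : ι) : SpecializesTo K x c (x i) (c i) := by
  simpa using of_aeval (K := K) (x := x) (c := c) (X i)

theorem of_algebraMap (k : K) :
    SpecializesTo K x c (algebraMap K T k) (algebraMap K L k) := by
  simpa using of_aeval (K := K) (x := x) (c := c) (C k)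

theorem add (h : SpecializesTo K x c t a) (h' : SpecializesTo K x c t' a') :
    SpecializesTo K x c (t + t') (a + a') := by
  obtain ⟨p, q, hq, h1, h2⟩ := h
  obtain ⟨p', q', hq', h1', h2'⟩ := h'
  refine ⟨p * q' + p' * q, q * q', by simp [hq, hq'], ?_, ?_⟩
  · simp only [map_add, map_mul, ← h1, ← h1']; ring
  · simp only [map_add, map_mul, h2, h2']; ring

theorem mul (h : SpecializesTo K x c t a) (h' : SpecializesTo K x c t' a') :
    SpecializesTo K x c (t * t') (a * a') := by
  obtain ⟨p, q, hq, h1, h2⟩ := h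
  obtain ⟨p', q', hq', h1', h2'⟩ := h'
  refine ⟨p * p', q * q', by simp [hq, hq'], ?_, ?_⟩
  · simp only [map_mul, ← h1, ← h1']; ring
  · simp only [map_mul, h2, h2']; ring

/-- If `t` vanished, independence of `x` would make the numerator the zero polynomial, and then `a`
would vanish too. This is what permits inverses. -/
theorem ne_zero (hx : AlgebraicIndependent K x) (h : SpecializesTo K x c t a) (ha : a ≠ 0) :
    t ≠ 0 := by
  obtain ⟨p, q, hq, h1, h2⟩ := h
  rintro rfl
  rw [zero_mul, eq_comm, ← map_zero (aeval x : MvPolynomial ι K →ₐ[K] T)] at h1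
  have hp : p = 0 := algebraicIndependent_iff_injective_aeval.1 hx h1
  rw [hp, map_zero, eq_comm] at h2
  exact mul_ne_zero ha hq h2

theorem inv (hx : AlgebraicIndependent K x) (h : SpecializesTo K x c t a) (ha : a ≠ 0) :
    SpecializesTo K x c t⁻¹ a⁻¹ := by
  have ht := h.ne_zero hx ha
  obtain ⟨p, q, hq, h1, h2⟩ := h
  refine ⟨q, p, h2 ▸ mul_ne_zero ha hq, ?_, ?_⟩
  · rw [← h1, inv_mul_cancel_left₀ ht]
  · rw [h2, inv_mul_cancel_left₀ ha]

theorem comp_equiv (e : κ ≃ ι) (h : SpecializesTo K x c t a) :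
    SpecializesTo K (x ∘ e) (c ∘ e) t a := by
  obtain ⟨p, q, hq, h1, h2⟩ := h
  refine ⟨rename e.symm p, rename e.symm q, ?_, ?_, ?_⟩ <;>
    simpa only [aeval_rename, Function.comp_assoc, Equiv.self_comp_symm, Function.comp_id]

theorem of_adjoin_eq_top (hx : AlgebraicIndependent K x) (i : L →ₐ[K] T) {S : Set L}
    (hS : IntermediateField.adjoin K S = ⊤) (h : ∀ a ∈ S, SpecializesTo K x c (i a) a) (a : L) :
    SpecializesTo K x c (i a) a := by
  have ha : a ∈ IntermediateField.adjoin K S := hS ▸ IntermediateField.mem_top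
  induction ha using IntermediateField.adjoin_induction with
  | mem a ha => exact h a ha
  | algebraMap k => rw [i.commutes]; exact .of_algebraMap k
  | add a b _ _ ha hb => rw [map_add]; exact ha.add hb
  | mul a b _ _ ha hb => rw [map_mul]; exact ha.mul hb
  | inv a _ ha =>
    by_cases h0 : a = 0
    · simpa [h0] using SpecializesTo.of_algebraMap (K := K) (x := x) (c := c) 0
    · rw [map_inv₀]; exact ha.inv hx h0

end SpecializesTo

theorem Localization.exists_away_algHom {P : Type*} [CommRing P] [Algebra K P]
    (f : MvPolynomial ι K) (g : MvPolynomial ι K →ₐ[K] P) (hf : IsUnit (g f)) :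
    ∃ l : Localization.Away f →ₐ[K] P, ∀ p, l (algebraMap _ _ p) = g p := by
  have hg : ∀ y : Submonoid.powers f, IsUnit (g y) := by
    rintro ⟨_, n, rfl⟩
    simpa using hf.pow n
  refine ⟨IsLocalization.liftAlgHom (M := Submonoid.powers f) hg, fun p => ?_⟩
  rw [IsLocalization.liftAlgHom_apply]
  exact IsLocalization.lift_eq (g := (g : MvPolynomial ι K →+* P)) hg p

theorem Localization.mem_range_of_mul_eq {x : ι → T} {f : MvPolynomial ι K}
    (hf : (aeval x : MvPolynomial ι K →ₐ[K] T) f ≠ 0) {l : Localization.Away f →ₐ[K] T}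
    (hl : ∀ p : MvPolynomial ι K, l (algebraMap _ _ p) = aeval x p) {t : T} {u : MvPolynomial ι K}
    (h : t * aeval (R := K) x f = aeval (R := K) x u) : t ∈ l.range := by
  refine ⟨IsLocalization.mk' _ u (⟨f, 1, pow_one _⟩ : Submonoid.powers f), mul_right_cancel₀ hf ?_⟩
  have := congrArg l (IsLocalization.mk'_spec (Localization.Away f) u
    (⟨f, 1, pow_one _⟩ : Submonoid.powers f))
  rw [map_mul, hl, hl] at this
  rw [h]
  exact this

theorem Subalgebra.exists_algHom_of_isFractionRing {A : Subalgebra K L} [IsFractionRing A L]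
    (g : A →ₐ[K] T) (hg : Function.Injective g) :
    ∃ j : L →ₐ[K] T, ∀ a : A, j (algebraMap A L a) = g a :=
  ⟨IsFractionRing.liftAlgHom (K := L) hg, fun a => by
    rw [IsFractionRing.liftAlgHom_apply]
    exact IsFractionRing.lift_algebraMap (K := L) (g := (g : A →+* T)) hg a⟩

/-- The retraction `r` is evaluation at the point c = (r(X_k)), and r ∘ i = id says that `i a` has
value `a` there. Powers of `f` are admissible denominators because `r` sends `f` to a unit. -/
theorem IsRetractRationalExt.exists_specializesTo (h : IsRetractRationalExt K L) :
    ∃ (n : ℕ) (c : Fin n → L) (i : L →ₐ[K] RatFunField K (Fin n)),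
      ∀ a, SpecializesTo K (RatFunField.x K) c (i a) a := by
  obtain ⟨A, -, hA, n, f, hf, i, r, hri⟩ := h
  have hx := (RatFunField.isPureBasis_x K (Fin n)).1
  have hx' := algebraicIndependent_iff_injective_aeval.1 hx
  have hfx : aeval (RatFunField.x K : Fin n → RatFunField K (Fin n)) f ≠ 0 := by
    rwa [Ne, ← map_zero (aeval (RatFunField.x K) : MvPolynomial (Fin n) K →ₐ[K] _), hx'.eq_iff]
  obtain ⟨l, hl⟩ := Localization.exists_away_algHom f (aeval (RatFunField.x K)) hfx.isUnit
  have hlf : ∀ z, l z = 0 → z = 0 := by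
    intro z hz
    obtain ⟨k, p, hp⟩ := IsLocalization.Away.surj f z
    have h1 := congrArg l hp
    rw [map_mul, hz, zero_mul, hl, eq_comm,
      ← map_zero (aeval (RatFunField.x K) : MvPolynomial (Fin n) K →ₐ[K] _), hx'.eq_iff] at h1
    rw [h1, map_zero] at hp
    exact ((IsLocalization.Away.algebraMap_isUnit f).pow k).mul_left_eq_zero.1 hp
  have hinj : Function.Injective (l.comp i) :=
    ((injective_iff_map_eq_zero l).2 hlf).comp
      (Function.LeftInverse.injective (g := r) fun a => DFunLike.congr_fun hri a)
  let c : Fin n → L := fun k => (r (algebraMap (MvPolynomial (Fin n) K) _ (X k)) : A)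
  have hc : ∀ p : MvPolynomial (Fin n) K, aeval c p = (r (algebraMap _ _ p) : L) := by
    have : (aeval c : MvPolynomial (Fin n) K →ₐ[K] L) = A.val.comp
        (r.comp (IsScalarTower.toAlgHom K (MvPolynomial (Fin n) K) (Localization.Away f))) := by
      ext k; simp [c]
    exact fun p => DFunLike.congr_fun this p
  have key : ∀ a : A, SpecializesTo K (RatFunField.x K) c (l (i a)) (a : L) := by
    intro a
    obtain ⟨k, p, hp⟩ := IsLocalization.Away.surj f (i a)
    refine ⟨p, f ^ k, ?_, ?_, ?_⟩
    · rw [hc]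
      have := (((IsLocalization.Away.algebraMap_isUnit (S := Localization.Away f) f).pow k).map
        (A.val.comp r)).ne_zero
      simpa using this
    · rw [← hl, ← hl, ← hp, map_mul, map_pow]
    · rw [hc, hc, ← hp, map_mul, Subalgebra.coe_mul, map_pow]
      rw [show r (i a) = a from DFunLike.congr_fun hri a]
      simp only [map_pow]
  obtain ⟨j, hj⟩ := Subalgebra.exists_algHom_of_isFractionRing (l.comp i) hinj
  refine ⟨n, c, j, fun a => ?_⟩
  obtain ⟨p, q, hq, rfl⟩ := IsFractionRing.div_surjective (A := A) a
  have hq0 : (algebraMap A L q) ≠ 0 := IsFractionRing.to_map_ne_zero_of_mem_nonZeroDivisors hq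
  rw [div_eq_mul_inv, map_mul, map_inv₀, hj, hj]
  exact (key p).mul ((key q).inv hx hq0)

/-- Let f₀ be a common denominator of the `i (c k)`. The algebra is A = K[c, f₀(c)⁻¹], with
retraction evaluation at `c`. To map A into K[x][1/f], the polynomial `f` must also invert `i
(f₀(c))`, which is why it acquires the extra factor `P`. -/
theorem isRetractRationalExt_of_specializesTo_fin {n : ℕ} {x : Fin n → T} {c : Fin n → L}
    (hx : AlgebraicIndependent K x) (i : L →ₐ[K] T) (h : ∀ a, SpecializesTo K x c (i a) a) :
    IsRetractRationalExt K L := by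
  have hx' := algebraicIndependent_iff_injective_aeval.1 hx
  have hx0 : ∀ {p : MvPolynomial (Fin n) K}, p ≠ 0 → aeval x p ≠ 0 := fun {p} hp => by
    rwa [Ne, ← map_zero (aeval x : MvPolynomial (Fin n) K →ₐ[K] T), hx'.eq_iff]
  have hc0 : ∀ {p : MvPolynomial (Fin n) K}, aeval c p ≠ 0 → p ≠ 0 := by
    rintro p hp rfl
    exact hp (map_zero _)
  choose p q hq hp1 hp2 using fun k => h (c k)
  let f₀ : MvPolynomial (Fin n) K := ∏ k, q k
  have hf₀c : aeval c f₀ ≠ 0 := by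
    rw [map_prod]; exact Finset.prod_ne_zero_iff.2 fun k _ => hq k
  have hf₀x := hx0 (hc0 hf₀c)
  obtain ⟨l₀, hl₀⟩ := Localization.exists_away_algHom f₀ (aeval x) hf₀x.isUnit
  have hdvd : ∀ k, q k ∣ f₀ := fun k => Finset.dvd_prod_of_mem q (Finset.mem_univ k)
  have hi₀ : i (aeval c f₀) ∈ l₀.range := by
    have : ∀ w : MvPolynomial (Fin n) K, i (aeval c w) ∈ l₀.range := by
      intro w
      induction w using MvPolynomial.induction_on with
      | C a => rw [aeval_C, i.commutes]; exact l₀.range.algebraMap_mem a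
      | add w w' hw hw' => rw [map_add, map_add]; exact add_mem hw hw'
      | mul_X w k hw =>
        rw [map_mul, map_mul, aeval_X]
        obtain ⟨s, hs⟩ := hdvd k
        exact mul_mem hw (Localization.mem_range_of_mul_eq hf₀x hl₀ (u := p k * s)
          (by rw [hs, map_mul, map_mul, ← mul_assoc, hp1]))
    exact this f₀
  obtain ⟨z, hz⟩ := hi₀
  obtain ⟨k₀, P, hP⟩ := IsLocalization.Away.surj f₀ z
  have hP1 : i (aeval c f₀) * aeval x f₀ ^ k₀ = aeval x P := by
    rw [← hl₀ P, ← hP, map_mul, ← hz, map_pow, hl₀]; rfl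
  -- Specializing the identity `hP1` at `c` shows that `P`, and hence `f`, takes as value a power of
  -- f₀(c), so evaluation at `c` extends to the localization with values in `A`.
  have hPc : aeval c P = aeval c f₀ * aeval c f₀ ^ k₀ := by
    obtain ⟨p', q', hq', h1, h2⟩ := h (aeval c f₀)
    have h3 : P * q' = p' * f₀ ^ k₀ := hx' (by
      rw [map_mul, map_mul, map_pow, ← hP1, ← h1]; ring)
    have h4 := congrArg (aeval c) h3
    rw [map_mul, map_mul, map_pow, h2] at h4
    refine mul_right_cancel₀ hq' (h4.trans ?_)
    ring
  let f := f₀ * P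
  have hfc : aeval c f = aeval c f₀ ^ (k₀ + 2) := by
    rw [map_mul, hPc]; ring
  have hf0 : f ≠ 0 := hc0 (by rw [hfc]; exact pow_ne_zero _ hf₀c)
  have hfx := hx0 hf0
  obtain ⟨l, hl⟩ := Localization.exists_away_algHom f (aeval x) hfx.isUnit
  let S : Set L := Set.range c ∪ {(aeval c f₀)⁻¹}
  let A : Subalgebra K L := Algebra.adjoin K S
  have hAc : ∀ w, aeval c w ∈ A := fun w =>
    Algebra.adjoin_mono (Set.subset_union_left (t := {(aeval c f₀)⁻¹}))
      (by rw [Algebra.adjoin_range_eq_range_aeval]; exact ⟨w, rfl⟩)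
  have hAi : (aeval c f₀)⁻¹ ∈ A := Algebra.subset_adjoin (Or.inr rfl)
  have hiA : ∀ a : A, i a ∈ l.range := by
    have : A ≤ l.range.comap i := by
      refine Algebra.adjoin_le ?_
      rintro _ (⟨k, rfl⟩ | rfl)
      · obtain ⟨s, hs⟩ := hdvd k
        exact Localization.mem_range_of_mul_eq hfx hl (t := i (c k)) (u := p k * s * P)
          (by simp only [f, hs, map_mul, ← hp1]; ring)
      · refine Localization.mem_range_of_mul_eq hfx hl (t := i _) (u := f₀ ^ (k₀ + 1)) ?_
        have : i (aeval c f₀) ≠ 0 := by simpa using hf₀c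
        rw [map_inv₀, map_mul, ← hP1, map_pow]
        field_simp
        ring
    exact fun a => this a.2
  have hlinj : Function.Injective l := by
    refine (injective_iff_map_eq_zero l).2 fun z hz => ?_
    obtain ⟨k, w, hw⟩ := IsLocalization.Away.surj f z
    have h1 := congrArg l hw
    rw [map_mul, hz, zero_mul, hl, eq_comm,
      ← map_zero (aeval x : MvPolynomial (Fin n) K →ₐ[K] T), hx'.eq_iff] at h1
    rw [h1, map_zero] at hw
    exact ((IsLocalization.Away.algebraMap_isUnit f).pow k).mul_left_eq_zero.1 hw
  let iA : A →ₐ[K] Localization.Away f :=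
    (AlgEquiv.ofInjective l hlinj).symm.toAlgHom.comp ((i.comp A.val).codRestrict l.range hiA)
  have hiA' : ∀ a : A, l (iA a) = i a := fun a =>
    congrArg Subtype.val ((AlgEquiv.ofInjective l hlinj).apply_symm_apply ⟨i a, hiA a⟩)
  let cA : Fin n → A := fun k => ⟨c k, Algebra.subset_adjoin (Or.inl ⟨k, rfl⟩)⟩
  have hcA : ∀ w, ((aeval cA w : A) : L) = aeval c w := fun w => by
    have : A.val.comp (aeval cA) = aeval c := by ext k; simp [cA]
    exact DFunLike.congr_fun this w
  obtain ⟨r, hr⟩ := Localization.exists_away_algHom f (aeval cA) (by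
    refine IsUnit.of_mul_eq_one (⟨_, hAi⟩ ^ (k₀ + 2)) (Subtype.ext ?_)
    rw [Subalgebra.coe_mul, hcA, hfc, Subalgebra.coe_pow, ← mul_pow, mul_inv_cancel₀ hf₀c, one_pow]
    rfl)
  refine ⟨A, ⟨((Set.finite_range c).union (Set.finite_singleton (aeval c f₀)⁻¹)).toFinset, by simp [A, S]⟩,
    IsFractionRing.of_field A L fun a => ?_, n, f, hf0, iA, r, AlgHom.ext fun a => ?_⟩
  · obtain ⟨p', q', hq', -, h2⟩ := h a
    exact ⟨⟨_, hAc p'⟩, ⟨_, hAc q'⟩, (eq_div_of_mul_eq hq' h2.symm)⟩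
  · obtain ⟨k, w, hw⟩ := IsLocalization.Away.surj f (iA a)
    have h1 := congrArg l hw
    rw [map_mul, hiA', map_pow, hl, hl] at h1
    have h2 := congrArg (fun z => ((r z : A) : L)) hw
    simp only [map_mul, map_pow, hr, Subalgebra.coe_mul, Subalgebra.coe_pow, hcA] at h2
    obtain ⟨p', q', hq', h3, h4⟩ := h a
    -- Both w/f^k and p'/q' represent `i a`; independence of `x` turns this into a polynomial
    -- identity that can be evaluated at `c`.
    have h5 : w * q' = p' * f ^ k := hx' (by
      rw [map_mul, map_mul, map_pow, ← h1, ← h3]; ring)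
    have h6 := congrArg (aeval c) h5
    rw [map_mul, map_mul, map_pow, h4, ← h2] at h6
    refine Subtype.ext ?_
    have hfc0 : aeval c f ^ k ≠ 0 := pow_ne_zero _ (by rw [hfc]; exact pow_ne_zero _ hf₀c)
    refine mul_right_cancel₀ (mul_ne_zero hfc0 hq') ?_
    rw [← mul_assoc]
    exact h6.trans (by rw [AlgHom.id_apply]; ring)

theorem isRetractRationalExt_of_specializesTo [Finite ι] {x : ι → T} {c : ι → L}
    (hx : AlgebraicIndependent K x) (i : L →ₐ[K] T) {S : Set L}
    (hS : IntermediateField.adjoin K S = ⊤) (h : ∀ a ∈ S, SpecializesTo K x c (i a) a) :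
    IsRetractRationalExt K L :=
  let e := (Finite.equivFin ι).symm
  isRetractRationalExt_of_specializesTo_fin (hx.comp e e.injective) i fun a =>
    (SpecializesTo.of_adjoin_eq_top hx i hS h a).comp_equiv e

theorem IsRationalExt.isRetractRationalExt (h : IsRationalExt K L) : IsRetractRationalExt K L := by
  obtain ⟨n, b, hb⟩ := isRationalExt_iff.1 h
  refine isRetractRationalExt_of_specializesTo (c := b) hb.1 (AlgHom.id K L) hb.2 ?_
  rintro _ ⟨k, rfl⟩
  exact .var k

end Retract

end

/-! ### Transitivity of the three properties in towers -/

noncomputable section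

open MvPolynomial

theorem exists_trdeg_eq_of_tower {K L M : Type*} [Field K] [Field L] [Field M] [Algebra K L]
    [Algebra K M] [Algebra L M] [IsScalarTower K L M] {n : ℕ} (hn : Algebra.trdeg K M = n) :
    ∃ a b : ℕ, Algebra.trdeg K L = a ∧ Algebra.trdeg L M = b ∧ n = a + b := by
  have h := lift_trdeg_add_eq K L M
  rw [hn, Cardinal.lift_natCast] at h
  have h1 : Cardinal.lift (Algebra.trdeg K L) < Cardinal.aleph0 :=
    (le_self_add.trans h.le).trans_lt Cardinal.natCast_lt_aleph0
  have h2 : Cardinal.lift (Algebra.trdeg L M) < Cardinal.aleph0 :=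
    (le_add_self.trans h.le).trans_lt Cardinal.natCast_lt_aleph0
  obtain ⟨a, ha⟩ := Cardinal.lt_aleph0.1 (Cardinal.lift_lt_aleph0.1 h1)
  obtain ⟨b, hb⟩ := Cardinal.lt_aleph0.1 (Cardinal.lift_lt_aleph0.1 h2)
  refine ⟨a, b, ha, hb, ?_⟩
  rw [ha, hb, Cardinal.lift_natCast, Cardinal.lift_natCast] at h
  exact_mod_cast h.symm

/-- The same numerator and denominator serve, with coefficients sent to `F` and variables renamed
along `e`. -/
theorem SpecializesTo.map {K F L L' T T' ι κ : Type*} [Field K] [Field F] [Field L] [Field L']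
    [Field T] [Field T'] [Algebra K F] [Algebra K L] [Algebra K T] [Algebra F L'] [Algebra F T']
    [Algebra K L'] [Algebra K T'] [IsScalarTower K F L'] [IsScalarTower K F T']
    {x : ι → T} {c : ι → L} {x' : κ → T'} {c' : κ → L'} {t : T} {a : L}
    (h : SpecializesTo K x c t a) (e : ι → κ) (u : T →ₐ[K] T') (v : L →ₐ[K] L')
    (hx : ∀ i, x' (e i) = u (x i)) (hc : ∀ i, c' (e i) = v (c i)) :
    SpecializesTo F x' c' (u t) (v a) := by
  obtain ⟨p, q, hq, h1, h2⟩ := h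
  have hu : ∀ p : MvPolynomial ι K,
      aeval x' (rename e (MvPolynomial.map (algebraMap K F) p)) = u (aeval x p) := fun p => by
    rw [aeval_rename, aeval_map_algebraMap, ← AlgHom.comp_apply, comp_aeval]
    exact congrArg (fun y => aeval y p) (funext hx)
  have hv : ∀ p : MvPolynomial ι K,
      aeval c' (rename e (MvPolynomial.map (algebraMap K F) p)) = v (aeval c p) := fun p => by
    rw [aeval_rename, aeval_map_algebraMap, ← AlgHom.comp_apply, comp_aeval]
    exact congrArg (fun y => aeval y p) (funext hc)
  refine ⟨rename e (MvPolynomial.map (algebraMap K F) p),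
    rename e (MvPolynomial.map (algebraMap K F) q), ?_, ?_, ?_⟩
  · rw [hv]; exact (map_ne_zero v).2 hq
  · rw [hu, hu, ← h1, map_mul]
  · rw [hv, hv, h2, map_mul]

section Trans

variable {K F N : Type*} [Field K] [Field F] [Field N] [Algebra K F] [Algebra F N] [Algebra K N]
  [IsScalarTower K F N]

theorem IsRationalExt.trans (h₁ : IsRationalExt K F) (h₂ : IsRationalExt F N) :
    IsRationalExt K N := by
  obtain ⟨n, b, hb⟩ := isRationalExt_iff.1 h₁
  obtain ⟨m, d, hd⟩ := isRationalExt_iff.1 h₂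
  exact (hb.sumElim_comp hd).isRationalExt

theorem IsStablyRationalExt.exists_trdeg_eq (h : IsStablyRationalExt K F) :
    ∃ a : ℕ, Algebra.trdeg K F = a := by
  obtain ⟨m, hm⟩ := h
  obtain ⟨l, d, hd⟩ := isRationalExt_iff.1 hm
  obtain ⟨a, -, ha, -⟩ := exists_trdeg_eq_of_tower (L := F) hd.trdeg_eq
  exact ⟨a, ha⟩

theorem IsStablyRationalExt.trans (h₁ : IsStablyRationalExt K F) (h₂ : IsStablyRationalExt F N) :
    IsStablyRationalExt K N := by
  obtain ⟨b, hb⟩ := h₁.exists_trdeg_eq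
  obtain ⟨e, he⟩ := h₂.exists_trdeg_eq
  obtain ⟨m, hm⟩ := h₂
  obtain ⟨l, d, hd⟩ := isRationalExt_iff.1 hm
  have hl : l = e + m := by
    have h1 := trdeg_tower he (RatFunField.isPureBasis_x N (Fin m)).trdeg_eq
    rw [hd.trdeg_eq, Nat.card_fin, Nat.card_fin] at h1
    exact_mod_cast h1
  -- Here `F` is the stably rational extension of `K`, and the basis `d` of N(y) over `F` supplies
  -- the further generators.
  refine h₁.of_adjoin_eq_top (F := K) (RatFunField.isPureBasis_x N (Fin m)) (v := d) ?_
    (trdeg_tower hb he) hb ?_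
  · set A := IntermediateField.adjoin K
      (Set.range (algebraMap F (RatFunField N (Fin m))) ∪ Set.range d)
    let B : IntermediateField F (RatFunField N (Fin m)) :=
      { A.toSubfield with
        algebraMap_mem' := fun a => IntermediateField.subset_adjoin K _ (Or.inl ⟨a, rfl⟩) }
    have h3 : IntermediateField.adjoin F (Set.range d) ≤ B := IntermediateField.adjoin_le_iff.2
      fun u hu => IntermediateField.subset_adjoin K _ (Or.inr hu)
    rw [hd.2] at h3
    exact eq_top_iff.2 fun u _ => h3 (IntermediateField.mem_top (x := u))
  · rw [Nat.card_fin, Nat.card_fin]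
    omega

/-- Specializations compose: `N` maps to F(Y), whose coefficients map on to K(X), and the point is
`c` joined with `d`. -/
theorem IsRetractRationalExt.trans (h₁ : IsRetractRationalExt K F)
    (h₂ : IsRetractRationalExt F N) : IsRetractRationalExt K N := by
  obtain ⟨m, d, j, hj⟩ := h₁.exists_specializesTo
  obtain ⟨n, c, i, hi⟩ := h₂.exists_specializesTo
  let _ : Algebra F (RatFunField K (Fin m)) := j.toRingHom.toAlgebra
  have : IsScalarTower K F (RatFunField K (Fin m)) :=
    IsScalarTower.of_algebraMap_eq fun k => (j.commutes k).symm
  obtain ⟨f, hf⟩ := RatFunField.exists_map F (RatFunField K (Fin m)) (Fin n)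
  have : IsScalarTower K F (RatFunField (RatFunField K (Fin m)) (Fin n)) :=
    IsScalarTower.of_algebraMap_eq fun k => by
      rw [IsScalarTower.algebraMap_apply F (RatFunField K (Fin m)),
        ← IsScalarTower.algebraMap_apply K F (RatFunField K (Fin m)),
        ← IsScalarTower.algebraMap_apply]
  have hx := ((RatFunField.isPureBasis_x K (Fin m)).sumElim_comp
    (RatFunField.isPureBasis_x (RatFunField K (Fin m)) (Fin n))).1
  set x' := Sum.elim (RatFunField.x (RatFunField K (Fin m)) : Fin n → _)
    (algebraMap (RatFunField K (Fin m)) (RatFunField (RatFunField K (Fin m)) (Fin n)) ∘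
      RatFunField.x K)
  let c' : Fin n ⊕ Fin m → N := Sum.elim c (algebraMap F N ∘ d)
  have key : ∀ p : MvPolynomial (Fin n) F,
      SpecializesTo K x' c' (f (aeval (RatFunField.x F) p)) (aeval c p) := by
    intro p
    induction p using MvPolynomial.induction_on with
    | C a =>
      rw [aeval_C, aeval_C, f.commutes,
        IsScalarTower.algebraMap_apply F (RatFunField K (Fin m))]
      exact (hj a).map (F := K) Sum.inr
        (IsScalarTower.toAlgHom K (RatFunField K (Fin m)) _) (IsScalarTower.toAlgHom K F N)
        (fun _ => rfl) (fun _ => rfl)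
    | add p q hp hq => rw [map_add, map_add, map_add]; exact hp.add hq
    | mul_X p k hp =>
      rw [map_mul, map_mul, map_mul, aeval_X, aeval_X, hf]
      exact hp.mul (SpecializesTo.var (K := K) (x := x') (c := c') (Sum.inl k))
  refine isRetractRationalExt_of_specializesTo (c := c') hx
    ((f.restrictScalars K).comp (i.restrictScalars K)) (S := Set.univ)
    (eq_top_iff.2 fun a _ => IntermediateField.subset_adjoin _ _ trivial) fun a _ => ?_
  obtain ⟨p, q, hq, h1, h2⟩ := hi a
  have h3 : f (i a) = f (aeval (RatFunField.x F) p) * (f (aeval (RatFunField.x F) q))⁻¹ := by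
    rw [← h1, map_mul, mul_inv_cancel_right₀ ((key q).ne_zero hx hq)]
  have h4 : a = aeval c p * (aeval c q)⁻¹ := by
    rw [h2, mul_inv_cancel_right₀ hq]
  have h5 := (key p).mul ((key q).inv hx hq)
  rw [← h3, ← h4] at h5
  exact h5

end Trans

end

noncomputable section

open MvPolynomial

/-! ### Passing from an extension `Q` = L(s) of `K` to an extension `N` of `F` generated by `L` and
`z` -/

section BaseChange

variable {K L Q F N κ : Type*} [Field K] [Field L] [Field Q] [Field F] [Field N] [Finite κ]
  [Algebra K L] [Algebra K Q] [Algebra L Q] [IsScalarTower K L Q]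
  [Algebra K F] [Algebra K N] [Algebra F N] [IsScalarTower K F N]
  [Algebra L N] [IsScalarTower K L N] {s : Q} {z : κ → N}

/-- The map s ↦ z_k embeds Q = L(s) in `N` over `L`. The image of a basis of `Q` over `K` generates
both `L` and z_k, and with the remaining z_i it has b + 1 + (|κ| - 1) members, exactly the
transcendence degree. -/
theorem isRationalExt_of_adjoin_eq_top (hs : IsPureBasis L (fun _ : Unit => s))
    (hz : AlgebraicIndependent L z)
    (hgen : IntermediateField.adjoin F (Set.range (algebraMap L N) ∪ Set.range z) = ⊤)
    {b : ℕ} (hL : Algebra.trdeg K L = b) (hN : Algebra.trdeg F N = (b + Nat.card κ : ℕ))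
    [Nonempty κ] (h : IsRationalExt K Q) : IsRationalExt F N := by
  classical
  obtain ⟨k⟩ := ‹Nonempty κ›
  obtain ⟨n, d, hd⟩ := isRationalExt_iff.1 h
  obtain ⟨f, hf⟩ := hs.exists_algHom (y := fun _ : Unit => z k)
    (hz.comp (fun _ : Unit => k) fun _ _ _ => rfl)
  have hn : n = b + 1 := by
    have h1 := trdeg_tower hL hs.trdeg_eq
    rw [hd.trdeg_eq, Nat.card_fin, Nat.card_unique] at h1
    exact_mod_cast h1
  refine (isPureBasis_of_card_le (x := Sum.elim (f ∘ d) (fun i : {i // i ≠ k} => z i)) hN ?_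
    ?_).isRationalExt
  · set A := IntermediateField.adjoin F
      (Set.range (Sum.elim (f ∘ d) (fun i : {i // i ≠ k} => z i)))
    have h1 : ∀ u, f u ∈ A := fun u =>
      IntermediateField.map_mem_adjoin_of_adjoin_eq_top hd.2 (f.restrictScalars K)
        (A.restrictScalars K)
        (by rintro _ ⟨i, rfl⟩; exact IntermediateField.subset_adjoin F _ ⟨Sum.inl i, rfl⟩) u
    rw [eq_top_iff, ← hgen, IntermediateField.adjoin_le_iff]
    rintro _ (⟨u, rfl⟩ | ⟨i, rfl⟩)
    · rw [← f.commutes]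
      exact h1 _
    · by_cases hi : i = k
      · rw [hi, ← hf ()]
        exact h1 _
      · exact IntermediateField.subset_adjoin F _ ⟨Sum.inr ⟨i, hi⟩, rfl⟩
  · have : Nat.card {i // i ≠ k} + 1 = Nat.card κ := by
      rw [← Finite.card_option]
      exact Nat.card_congr (Equiv.optionSubtypeNe k)
    rw [Nat.card_sum, Nat.card_fin]
    omega

/-- Since `Q` = L(s) is purely transcendental over `L`, stable rationality descends from `Q` to `L`;
no `z` has to replace `s`, so `κ` may be empty. -/
theorem isStablyRationalExt_of_adjoin_eq_top (hs : IsPureBasis L (fun _ : Unit => s))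
    (hgen : IntermediateField.adjoin F (Set.range (algebraMap L N) ∪ Set.range z) = ⊤)
    {b : ℕ} (hL : Algebra.trdeg K L = b) (hN : Algebra.trdeg F N = (b + Nat.card κ : ℕ))
    (h : IsStablyRationalExt K Q) : IsStablyRationalExt F N := by
  obtain ⟨m, hm⟩ := h
  obtain ⟨l, d, hd⟩ := isRationalExt_iff.1 hm
  have hL' : IsStablyRationalExt K L :=
    isStablyRationalExt_of_isPureBasis (hs.sumElim_comp (RatFunField.isPureBasis_x Q (Fin m))) hd
  refine hL'.of_adjoin_eq_top (F := F) (IsPureBasis.of_isEmpty_self (Fin.elim0 : Fin 0 → N))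
    hgen hN hL ?_
  simp

/-- Inside `M`, the field `N` lies in L(y, z). Mapping `L` to R = K(X) through `i` sends it to R(y,
z), where `F` lands in K(y). So X and z are independent over `F`, and they specialize to (c, z) in
`N`. -/
theorem isRetractRationalExt_of_adjoin_eq_top [Algebra Q N] [IsScalarTower L Q N]
    [IsScalarTower K Q N]
    {M ι : Type*} [Field M] [Algebra N M] [Algebra L M] [IsScalarTower L N M] [Algebra F M]
    [IsScalarTower F N M] [Algebra K M] [IsScalarTower K L M] {y : ι → M}
    (hy : AlgebraicIndependent L (Sum.elim y (algebraMap N M ∘ z)))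
    (hF : ∀ a : F, algebraMap F M a ∈ IntermediateField.adjoin K (Set.range y))
    (hgen : IntermediateField.adjoin F (Set.range (algebraMap L N) ∪ Set.range z) = ⊤)
    (h : IsRetractRationalExt K Q) : IsRetractRationalExt F N := by
  obtain ⟨n, c, i, hi⟩ := h.exists_specializesTo
  let R := RatFunField K (Fin n)
  let _ : Algebra L R := (i.toRingHom.comp (algebraMap L Q)).toAlgebra
  have hLR : ∀ a, algebraMap L R a = i (algebraMap L Q a) := fun _ => rfl
  have : IsScalarTower K L R := IsScalarTower.of_algebraMap_eq fun k => by
    rw [hLR, ← IsScalarTower.algebraMap_apply, i.commutes]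
  let T := RatFunField R (ι ⊕ κ)
  have hT := RatFunField.isPureBasis_x R (ι ⊕ κ)
  have : IsScalarTower K L T := IsScalarTower.of_algebraMap_eq fun k => by
    rw [IsScalarTower.algebraMap_apply L R T, ← IsScalarTower.algebraMap_apply K L R,
      ← IsScalarTower.algebraMap_apply]
  let A := IntermediateField.adjoin L (Set.range (Sum.elim y (algebraMap N M ∘ z)))
  obtain ⟨f, hf⟩ : ∃ f : A →ₐ[L] T, ∀ k, f ⟨Sum.elim y (algebraMap N M ∘ z) k,
      IntermediateField.subset_adjoin _ _ ⟨k, rfl⟩⟩ = RatFunField.x R k :=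
    hy.exists_adjoin_algHom (hT.1.restrictScalars (algebraMap L R).injective)
  have hyA : ∀ a ∈ IntermediateField.adjoin K (Set.range y), a ∈ A := by
    have : IntermediateField.adjoin K (Set.range y) ≤ A.restrictScalars K := by
      refine IntermediateField.adjoin_le_iff.2 ?_
      rintro _ ⟨j, rfl⟩
      exact IntermediateField.subset_adjoin L _ ⟨Sum.inl j, rfl⟩
    exact this
  let A' : IntermediateField F M := { A.toSubfield with algebraMap_mem' := fun a => hyA _ (hF a) }
  have hNA : ∀ a : N, algebraMap N M a ∈ A := by
    refine IntermediateField.map_mem_adjoin_of_adjoin_eq_top hgen (IsScalarTower.toAlgHom F N M)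
      A' ?_
    rintro _ (⟨a, rfl⟩ | ⟨k, rfl⟩)
    · have := A.algebraMap_mem a
      rw [IsScalarTower.algebraMap_apply L N M] at this
      exact this
    · exact IntermediateField.subset_adjoin L _ ⟨Sum.inr k, rfl⟩
  let g : N →+* T := (f : A →+* T).comp ((algebraMap N M).codRestrict A hNA)
  have hg : ∀ a, g a = f ⟨algebraMap N M a, hNA a⟩ := fun _ => rfl
  have hgL : ∀ a, g (algebraMap L N a) = algebraMap L T a := fun a => by
    rw [hg, ← f.commutes]
    exact congrArg f (Subtype.ext (IsScalarTower.algebraMap_apply L N M a).symm)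
  let _ : Algebra F T := (g.comp (algebraMap F N)).toAlgebra
  have hFT : ∀ a, algebraMap F T a = g (algebraMap F N a) := fun _ => rfl
  have : IsScalarTower K F T := IsScalarTower.of_algebraMap_eq fun k => by
    rw [hFT, ← IsScalarTower.algebraMap_apply, IsScalarTower.algebraMap_apply K L N, hgL,
      ← IsScalarTower.algebraMap_apply]
  let j : N →ₐ[F] T := { g with commutes' := fun a => rfl }
  let x : Fin n ⊕ κ → T := Sum.elim (fun k => algebraMap R T (RatFunField.x K k))
    (fun k => RatFunField.x R (Sum.inr k))
  let y' : ι → T := fun k => RatFunField.x R (Sum.inl k)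
  have hxy : AlgebraicIndependent K (Sum.elim x y') := by
    have := ((RatFunField.isPureBasis_x K (Fin n)).sumElim_comp hT).1
    refine (algebraicIndependent_equiv' ?_ ?_).1 this
    · exact ((Equiv.sumAssoc _ _ _).trans (Equiv.sumComm _ _)).trans
        (Equiv.sumCongr (Equiv.sumComm _ _) (Equiv.refl _))
    · ext ((k | k) | k) <;> rfl
  -- Independence of `x` over `F` is obtained from independence over the larger field K(y').
  set B := IntermediateField.adjoin K (Set.range y')
  have hxB : AlgebraicIndependent B x :=
    IntermediateField.algebraicIndependent_adjoin_iff.2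
      (AlgebraicIndependent.sumElim_iff.1 hxy).2
  have hFB : ∀ a, algebraMap F T a ∈ B := by
    have key : ∀ a (ha : a ∈ IntermediateField.adjoin K (Set.range y)),
        f ⟨a, hyA a ha⟩ ∈ B := by
      have : IntermediateField.adjoin K (Set.range y) ≤
          (B.comap (f.restrictScalars K)).map ((A.val).restrictScalars K) := by
        refine IntermediateField.adjoin_le_iff.2 ?_
        rintro _ ⟨k, rfl⟩
        refine ⟨⟨y k, IntermediateField.subset_adjoin L _ ⟨Sum.inl k, rfl⟩⟩, ?_, rfl⟩
        have h1 : y' k ∈ B := IntermediateField.subset_adjoin K _ ⟨k, rfl⟩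
        exact (congrArg (· ∈ B) (hf (Sum.inl k))).mpr h1
      rintro a ha
      obtain ⟨a', ha', rfl⟩ := this ha
      exact ha'
    intro a
    rw [hFT, hg]
    convert! key _ (hF a) using 2
    exact Subtype.ext (IsScalarTower.algebraMap_apply F N M a).symm
  let _ : Algebra F B := ((algebraMap F T).codRestrict B hFB).toAlgebra
  have : IsScalarTower F B T := IsScalarTower.of_algebraMap_eq fun _ => rfl
  have hxF : AlgebraicIndependent F x := hxB.restrictScalars (algebraMap F B).injective
  let c' : Fin n ⊕ κ → N := Sum.elim (fun k => algebraMap Q N (c k)) z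
  refine isRetractRationalExt_of_specializesTo (c := c') hxF j hgen ?_
  rintro _ (⟨a, rfl⟩ | ⟨k, rfl⟩)
  · have h1 := (hi (algebraMap L Q a)).map (F := F) (x' := x) (c' := c') Sum.inl
      (IsScalarTower.toAlgHom K R T) (IsScalarTower.toAlgHom K Q N) (fun _ => rfl) (fun _ => rfl)
    have h2 : j (algebraMap L N a) = algebraMap R T (i (algebraMap L Q a)) := by
      rw [← hLR, ← IsScalarTower.algebraMap_apply]
      exact hgL a
    rw [h2, IsScalarTower.algebraMap_apply L Q N]
    exact h1
  · have h1 : j (z k) = x (Sum.inr k) :=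
      (congrArg f (Subtype.ext rfl)).trans (hf (Sum.inr k))
    rw [h1]
    exact .var (c := c') (Sum.inr k)

end BaseChange

end

noncomputable section

/-! ### Orbit polynomials, interpolation and averaging for finite group actions -/

section FixedField

variable {K M M' Γ : Type*} [Field K] [Field M] [Algebra K M] [Field M'] [Algebra K M'] [Group Γ]
  (ρ : Γ →* (M ≃ₐ[K] M))

theorem mem_fixedField_range {a : M} :
    a ∈ IntermediateField.fixedField ρ.range ↔ ∀ γ, ρ γ a = a := by
  simp [IntermediateField.mem_fixedField_iff]

variable [Fintype Γ]

theorem sum_mem_fixedField (a : M) : ∑ γ, ρ γ a ∈ IntermediateField.fixedField ρ.range := by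
  refine (mem_fixedField_range ρ).2 fun δ => ?_
  rw [map_sum]
  refine Fintype.sum_equiv (Equiv.mulLeft δ) _ _ fun γ => ?_
  simp

/-- The conjugates of `θ` are distinct, and the `e i` are the coefficients of the Lagrange basis
polynomial at the node `ρ γ θ`. -/
theorem sum_sum_pow_eq_ite [DecidableEq Γ] {θ : M} (hθ : ∀ γ, ρ γ θ = θ → γ = 1) (γ : Γ) :
    ∃ e : ℕ → M, (∀ i, e i ∈ IntermediateField.adjoin K (Set.range fun δ => ρ δ θ)) ∧
      ∀ δ, ∑ i ∈ Finset.range (Fintype.card Γ), e i * ρ δ θ ^ i = if δ = γ then 1 else 0 := by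
  set E := IntermediateField.adjoin K (Set.range fun δ => ρ δ θ)
  let v : Γ → E := fun δ => ⟨ρ δ θ, IntermediateField.subset_adjoin _ _ ⟨δ, rfl⟩⟩
  have hv : Set.InjOn v (Finset.univ : Finset Γ) := fun δ _ δ' _ h => by
    have h1 : ρ δ θ = ρ δ' θ := congrArg Subtype.val h
    have h2 : ρ (δ'⁻¹ * δ) θ = θ := by
      rw [map_mul, AlgEquiv.mul_apply, h1, ← AlgEquiv.mul_apply, ← map_mul, inv_mul_cancel, map_one,
        AlgEquiv.one_apply]
    exact (inv_mul_eq_one.1 (hθ _ h2)).symm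
  let p := Lagrange.basis Finset.univ v γ
  have hp : p.natDegree < Fintype.card Γ := by
    have := Lagrange.degree_basis hv (Finset.mem_univ γ)
    rw [Polynomial.natDegree_eq_of_degree_eq_some this, Finset.card_univ]
    exact Nat.sub_lt Fintype.card_pos one_pos
  refine ⟨fun i => p.coeff i, fun i => (p.coeff i).2, fun δ => ?_⟩
  have h1 := congrArg (algebraMap E M) (Polynomial.eval_eq_sum_range' hp (v δ))
  rw [map_sum] at h1
  refine (Finset.sum_congr rfl fun i _ => ?_).trans (h1.symm.trans ?_)
  · rw [map_mul, map_pow]; rfl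
  · split_ifs with h
    · rw [h, Lagrange.eval_basis_self hv (Finset.mem_univ γ), map_one]
    · rw [Lagrange.eval_basis_of_ne (Ne.symm h) (Finset.mem_univ δ), map_zero]

/-- Summing the interpolation identity over the group writes 1 as a combination of traces of powers
of `θ`. Some trace is therefore nonzero, and dividing that power by its trace gives `c`. -/
theorem exists_sum_eq_one {θ : M} (hθ : ∀ γ, ρ γ θ = θ → γ = 1) :
    ∃ c ∈ IntermediateField.adjoin K (Set.range fun δ => ρ δ θ), ∑ γ, ρ γ c = 1 := by
  classical
  obtain ⟨e, -, he⟩ := sum_sum_pow_eq_ite ρ hθ 1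
  have h1 : ∑ i ∈ Finset.range (Fintype.card Γ), e i * ∑ γ, ρ γ (θ ^ i) = 1 := by
    simp_rw [Finset.mul_sum, map_pow]
    rw [Finset.sum_comm]
    simp_rw [he]
    simp
  obtain ⟨i, -, hi⟩ := Finset.exists_ne_zero_of_sum_ne_zero (h1.trans_ne one_ne_zero)
  have hi' : ∑ γ, ρ γ (θ ^ i) ≠ 0 := right_ne_zero_of_mul hi
  have hfix := (mem_fixedField_range ρ).1 (sum_mem_fixedField ρ (θ ^ i))
  have hmem : ∀ γ, ρ γ (θ ^ i) ∈ IntermediateField.adjoin K (Set.range fun δ => ρ δ θ) :=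
    fun γ => by
      rw [map_pow]
      exact pow_mem (IntermediateField.subset_adjoin K (Set.range fun δ => ρ δ θ) ⟨γ, rfl⟩) i
  refine ⟨θ ^ i * (∑ γ, ρ γ (θ ^ i))⁻¹, mul_mem ?_ (inv_mem (sum_mem fun γ _ => hmem γ)), ?_⟩
  · simpa using hmem 1
  · simp_rw [map_mul, map_inv₀, hfix]
    rw [← Finset.sum_mul, mul_inv_cancel₀ hi']

/-- The map m ↦ Tr(mc) is `F`-linear and fixes every invariant because Tr(c) = 1. It takes values in
`F` as soon as it does so on a spanning set. -/
theorem fixedField_le_of_span_eq_top {F : IntermediateField K M}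
    {S : Set M} (hS : Submodule.span F S = ⊤) {c : M} (hc : ∑ γ, ρ γ c = 1)
    (hF : ∀ a ∈ F, ∀ γ, ρ γ a = a) (h : ∀ s ∈ S, ∑ γ, ρ γ (s * c) ∈ F) :
    IntermediateField.fixedField ρ.range ≤ F := by
  have key : ∀ m : M, ∑ γ, ρ γ (m * c) ∈ F := by
    intro m
    have hm : m ∈ Submodule.span F S := hS ▸ Submodule.mem_top
    induction hm using Submodule.span_induction with
    | mem s hs => exact h s hs
    | zero => simp
    | add a b _ _ ha hb =>
      simp_rw [add_mul, map_add]
      rw [Finset.sum_add_distrib]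
      exact add_mem ha hb
    | smul a b _ hb =>
      simp_rw [IntermediateField.smul_def, smul_eq_mul, mul_assoc, map_mul _ (a : M),
        hF _ a.2]
      rw [← Finset.mul_sum]
      exact mul_mem a.2 hb
  intro m hm
  have h1 := key m
  simp_rw [map_mul, (mem_fixedField_range ρ).1 hm] at h1
  rwa [← Finset.mul_sum, hc, mul_one] at h1

/-- Algebraic elements generate the same field as algebra, and an algebra is spanned by the
monomials in its generators. -/
theorem span_mul_eq_top {F : IntermediateField K M} (A B : Submonoid M)
    (hA : ∀ a ∈ A, IsAlgebraic F a) (hB : ∀ b ∈ B, IsAlgebraic F b)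
    (h : IntermediateField.adjoin F ((A : Set M) ∪ B) = ⊤) :
    Submodule.span F {m | ∃ a ∈ A, ∃ b ∈ B, a * b = m} = ⊤ := by
  rw [IntermediateField.adjoin_eq_top_iff_of_isAlgebraic
    (by rintro x (hx | hx); exacts [hA x hx, hB x hx])] at h
  have h1 := Algebra.adjoin_eq_span F ((A : Set M) ∪ B)
  rw [h, Algebra.top_toSubmodule, Submonoid.closure_union, Submonoid.closure_eq,
    Submonoid.closure_eq] at h1
  rw [h1]
  congr 1
  ext m
  exact Submonoid.mem_sup.symm

/-- The orbit polynomial ∏ (X - γa) has invariant coefficients in `E`, which `f` carries into `F`.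
-/
theorem isAlgebraic_of_fixedField_le {E : IntermediateField K M}
    (hE : ∀ a ∈ E, ∀ γ, ρ γ a ∈ E) (f : M →ₐ[K] M') {F : IntermediateField K M'}
    (hF : ∀ a ∈ E, a ∈ IntermediateField.fixedField ρ.range → f a ∈ F) {a : M} (ha : a ∈ E) :
    IsAlgebraic F (f a) := by
  classical
  let p : Polynomial E := ∏ γ, (Polynomial.X - Polynomial.C ⟨ρ γ a, hE a ha γ⟩)
  have hp : p.Monic := Polynomial.monic_prod_of_monic _ _ fun γ _ => Polynomial.monic_X_sub_C _
  let q : Polynomial M := p.map (algebraMap E M)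
  have hq : q = ∏ γ, (Polynomial.X - Polynomial.C (ρ γ a)) := by
    simp only [q, p, Polynomial.map_prod, Polynomial.map_sub, Polynomial.map_X, Polynomial.map_C]
    rfl
  have hqρ : ∀ δ, q.map (ρ δ : M →+* M) = q := by
    intro δ
    rw [hq, Polynomial.map_prod]
    refine Fintype.prod_equiv (Equiv.mulLeft δ) _ _ fun γ => ?_
    simp
  have hcoeff : ∀ n, q.coeff n ∈ E ∧ q.coeff n ∈ IntermediateField.fixedField ρ.range := by
    refine fun n => ⟨?_, (mem_fixedField_range ρ).2 fun δ => ?_⟩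
    · rw [Polynomial.coeff_map]; exact (p.coeff n).2
    · conv_rhs => rw [← hqρ δ, Polynomial.coeff_map]
      rfl
  have hlift : q.map (f : M →+* M') ∈ Polynomial.lifts (algebraMap F M') := by
    refine (Polynomial.lifts_iff_coeff_lifts _).2 fun n => ?_
    rw [Polynomial.coeff_map]
    exact ⟨⟨_, hF _ (hcoeff n).1 (hcoeff n).2⟩, rfl⟩
  obtain ⟨r, hr, -, hr'⟩ := Polynomial.lifts_and_degree_eq_and_monic hlift
    ((hp.map _).map _)
  refine IsIntegral.isAlgebraic ⟨r, hr', ?_⟩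
  rw [← Polynomial.eval_map, hr]
  have : q.eval a = 0 := by
    rw [hq, Polynomial.eval_prod]
    exact Finset.prod_eq_zero (Finset.mem_univ 1) (by simp)
  have h2 := Polynomial.eval_map_apply (f := (f : M →+* M')) (p := q) a
  rw [this, map_zero] at h2
  exact h2

end FixedField

/-! ### Equivariant embeddings attached to surjective group homomorphisms -/

section FiberSum

variable (K : Type*) {Γ Q : Type*} [Field K] [Group Γ] [Group Q] [Fintype Γ] [DecidableEq Q]

theorem IsPureBasis.algHom_ext {K L M ι : Type*} [Field K] [Field L] [Field M] [Algebra K L]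
    [Algebra K M] {x : ι → L} (hx : IsPureBasis K x) {f g : L →ₐ[K] M}
    (h : ∀ i, f (x i) = g (x i)) : f = g := by
  ext a
  have ha : a ∈ IntermediateField.adjoin K (Set.range x) := hx.2 ▸ IntermediateField.mem_top
  induction ha using IntermediateField.adjoin_induction with
  | mem a ha => obtain ⟨i, rfl⟩ := ha; exact h i
  | algebraMap k => rw [f.commutes, g.commutes]
  | add a b _ _ ha hb => rw [map_add, map_add, ha, hb]
  | mul a b _ _ ha hb => rw [map_mul, map_mul, ha, hb]
  | inv a _ ha => rw [map_inv₀, map_inv₀, ha]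

/-- Setting all variables but one in each fibre to zero turns the fibre sums into distinct
variables. -/
theorem algebraicIndependent_sum_fiber {π : Γ →* Q} (hπ : Function.Surjective π) :
    AlgebraicIndependent K (fun q => ∑ γ with π γ = q, RatFunField.x K γ) := by
  classical
  obtain ⟨σ, hσ⟩ := hπ.hasRightInverse
  let r : MvPolynomial Γ K →ₐ[K] MvPolynomial Q K :=
    MvPolynomial.aeval fun γ => if γ = σ (π γ) then MvPolynomial.X (π γ) else 0
  let y : Q → MvPolynomial Γ K := fun q => ∑ γ with π γ = q, MvPolynomial.X γ
  have hy : AlgebraicIndependent K y := by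
    refine AlgebraicIndependent.of_comp r ?_
    convert! MvPolynomial.algebraicIndependent_X Q K using 1
    ext1 q
    simp only [Function.comp_apply, y, r, map_sum, MvPolynomial.aeval_X]
    rw [Finset.sum_eq_single (σ q)]
    · simp [hσ q]
    · intro γ hγ hne
      rw [if_neg]
      rw [(Finset.mem_filter.1 hγ).2]
      exact hne
    · intro h
      exact (h (Finset.mem_filter.2 ⟨Finset.mem_univ (σ q), hσ q⟩)).elim
  have := hy.map' (f := IsScalarTower.toAlgHom K (MvPolynomial Γ K) (RatFunField K Γ))
    (IsFractionRing.injective _ _)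
  convert! this using 1
  ext1 q
  simp [y, RatFunField.x]

/-- The embedding `K(x(q) : q ∈ Q) → K(x(γ) : γ ∈ Γ)` attached to a surjective homomorphism
`π : Γ → Q` that sends a variable to the sum of the variables above it. -/
def fiberSum {π : Γ →* Q} (hπ : Function.Surjective π) : RatFunField K Q →ₐ[K] RatFunField K Γ :=
  ((RatFunField.isPureBasis_x K Q).exists_algHom (algebraicIndependent_sum_fiber K hπ)).choose

variable {K} {π : Γ →* Q} (hπ : Function.Surjective π)

theorem fiberSum_x (q : Q) :
    fiberSum K hπ (RatFunField.x K q) = ∑ γ with π γ = q, RatFunField.x K γ :=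
  ((RatFunField.isPureBasis_x K Q).exists_algHom
    (algebraicIndependent_sum_fiber K hπ)).choose_spec q

theorem regularAction_fiberSum (γ : Γ) (a : RatFunField K Q) :
    regularAction K Γ γ (fiberSum K hπ a) = fiberSum K hπ (regularAction K Q (π γ) a) := by
  have : (regularAction K Γ γ).toAlgHom.comp (fiberSum K hπ) =
      (fiberSum K hπ).comp (regularAction K Q (π γ)).toAlgHom := by
    refine (RatFunField.isPureBasis_x K Q).algHom_ext fun q => ?_
    change regularAction K Γ γ (fiberSum K hπ _) = fiberSum K hπ (regularAction K Q (π γ) _)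
    rw [regularAction_x, fiberSum_x, fiberSum_x, map_sum]
    refine Finset.sum_equiv (Equiv.mulLeft γ) (fun δ => ?_) fun δ _ => ?_
    · simp
    · rw [regularAction_x, Equiv.coe_mulLeft]
  exact DFunLike.congr_fun this a

theorem fiberSum_mem_noetherField {a : RatFunField K Q} (ha : a ∈ NoetherField K Q) :
    fiberSum K hπ a ∈ NoetherField K Γ := by
  refine (mem_fixedField_range _).2 fun γ => ?_
  rw [regularAction_fiberSum, (mem_fixedField_range _).1 ha]

/-- The embedding of Noether fields attached to a surjective homomorphism `π : Γ → Q`. -/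
def noetherFieldMap : NoetherField K Q →ₐ[K] NoetherField K Γ where
  toRingHom := ((fiberSum K hπ : RatFunField K Q →+* RatFunField K Γ).comp
    (algebraMap (NoetherField K Q) (RatFunField K Q))).codRestrict (NoetherField K Γ)
      fun a => fiberSum_mem_noetherField hπ a.2
  commutes' k := Subtype.ext ((fiberSum K hπ).commutes k)

theorem noetherFieldMap_surjective (hinj : Function.Injective π) :
    Function.Surjective (noetherFieldMap (K := K) hπ) := by
  have hsurj : Function.Surjective (fiberSum K hπ) := by
    rw [← AlgHom.fieldRange_eq_top, eq_top_iff, ← (RatFunField.isPureBasis_x K Γ).2,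
      IntermediateField.adjoin_le_iff]
    rintro _ ⟨γ, rfl⟩
    refine ⟨RatFunField.x K (π γ), ?_⟩
    change fiberSum K hπ _ = _
    have : (Finset.univ.filter fun δ => π δ = π γ) = {γ} := by
      ext δ
      simp [hinj.eq_iff]
    rw [fiberSum_x, this, Finset.sum_singleton]
  rintro ⟨b, hb⟩
  obtain ⟨a, rfl⟩ := hsurj b
  refine ⟨⟨a, (mem_fixedField_range _).2 fun q => ?_⟩, rfl⟩
  obtain ⟨γ, rfl⟩ := hπ q
  have := (mem_fixedField_range _).1 hb γ
  rw [regularAction_fiberSum] at this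
  exact (fiberSum K hπ).injective this

end FiberSum

end

noncomputable section

/-! ### Degree-zero quotients of variables, and K(H) = L(s) -/

section Proj

variable (K H : Type*) [Field K] [Group H] [Fintype H]

/-- The sum of all variables. -/
def varSum : RatFunField K H := ∑ h, RatFunField.x K h

variable {H} in
/-- The variable `x(h)` divided by the sum of all variables. -/
def projVar (h : H) : RatFunField K H := RatFunField.x K h / varSum K H

/-- The field generated by the quotients of the variables. -/
def projField : IntermediateField K (RatFunField K H) :=
  IntermediateField.adjoin K (Set.range (projVar K : H → RatFunField K H))

theorem varSum_ne_zero : varSum K H ≠ 0 := by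
  intro h
  have := Fintype.linearIndependent_iff.1 (RatFunField.isPureBasis_x K H).1.linearIndependent
    (fun _ => 1) (by simpa [varSum] using h) 1
  exact one_ne_zero this

variable {K H}

theorem projVar_mul_varSum (h : H) : projVar K h * varSum K H = RatFunField.x K h :=
  div_mul_cancel₀ _ (varSum_ne_zero K H)

omit [Group H] in
theorem projVar_mem (h : H) : projVar K h ∈ projField K H :=
  IntermediateField.subset_adjoin _ _ ⟨h, rfl⟩

theorem regularAction_varSum (h : H) : regularAction K H h (varSum K H) = varSum K H := by
  rw [varSum, map_sum]
  exact Fintype.sum_equiv (Equiv.mulLeft h) _ _ fun k => regularAction_x K h k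

theorem regularAction_projVar (h k : H) :
    regularAction K H h (projVar K k) = projVar K (h * k) := by
  rw [projVar, map_div₀, regularAction_x, regularAction_varSum, projVar]

theorem varSum_mem_noetherField : varSum K H ∈ NoetherField K H :=
  (mem_fixedField_range _).2 regularAction_varSum

theorem regularAction_mem_projField {a : RatFunField K H} (ha : a ∈ projField K H) (h : H) :
    regularAction K H h a ∈ projField K H := by
  have : projField K H ≤ (projField K H).comap (regularAction K H h).toAlgHom := by
    refine IntermediateField.adjoin_le_iff.2 ?_
    rintro _ ⟨k, rfl⟩
    change regularAction K H h _ ∈ projField K H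
    rw [regularAction_projVar]
    exact projVar_mem _
  exact this ha

omit [Group H] [Fintype H] in
theorem RatFunField.x_injective : Function.Injective (RatFunField.x K : H → RatFunField K H) :=
  (RatFunField.isPureBasis_x K H).1.injective

theorem eq_one_of_regularAction_projVar (h : H)
    (hh : regularAction K H h (projVar K 1) = projVar K 1) : h = 1 := by
  rw [regularAction_projVar, mul_one] at hh
  refine RatFunField.x_injective (K := K) ?_
  rw [← projVar_mul_varSum, hh, projVar_mul_varSum]

theorem range_regularAction_projVar :
    (Set.range fun h => regularAction K H h (projVar K 1)) =
      Set.range (projVar K : H → RatFunField K H) := by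
  simp_rw [regularAction_projVar, mul_one]

theorem projVar_one [DecidableEq H] : projVar K (1 : H) = 1 - ∑ h : {h : H // h ≠ 1}, projVar K h.1 := by
  have h1 : ∑ h : H, projVar K h = 1 := by
    simp_rw [projVar]
    rw [← Finset.sum_div]
    exact div_self (varSum_ne_zero K H)
  rw [← h1, eq_sub_iff_add_eq, Fintype.sum_eq_add_sum_subtype_ne _ (1 : H)]

theorem projField_eq_adjoin :
    projField K H = IntermediateField.adjoin K (Set.range fun h : {h : H // h ≠ 1} => projVar K h.1) := by
  classical
  refine le_antisymm (IntermediateField.adjoin_le_iff.2 ?_) (IntermediateField.adjoin.mono _ _ _ ?_)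
  · have h0 : ∀ h : {h : H // h ≠ 1}, projVar K h.1 ∈
        IntermediateField.adjoin K (Set.range fun h : {h : H // h ≠ 1} => projVar K h.1) :=
      fun h => IntermediateField.subset_adjoin _ _ ⟨h, rfl⟩
    rintro _ ⟨h, rfl⟩
    by_cases hh : h = 1
    · rw [hh, projVar_one]
      exact sub_mem (one_mem _) (sum_mem fun h _ => h0 h)
    · exact h0 ⟨h, hh⟩
  · rintro _ ⟨h, rfl⟩
    exact ⟨h.1, rfl⟩

theorem card_ne_one_add_one : Nat.card {h : H // h ≠ 1} + 1 = Nat.card H := by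
  classical
  rw [← Finite.card_option]
  exact Nat.card_congr (Equiv.optionSubtypeNe 1)

theorem algebraicIndependent_projField_varSum :
    AlgebraicIndependent (projField K H) (fun _ : Unit => varSum K H) := by
  have h1 : IsPureBasis K (Sum.elim (fun _ : Unit => varSum K H)
      (fun h : {h : H // h ≠ 1} => projVar K h.1)) := by
    refine isPureBasis_of_card_le (RatFunField.isPureBasis_x K H).trdeg_eq ?_ ?_
    · set A := IntermediateField.adjoin K (Set.range (Sum.elim (fun _ : Unit => varSum K H)
        (fun h : {h : H // h ≠ 1} => projVar K h.1)))
      have h2 : projField K H ≤ A := by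
        rw [projField_eq_adjoin]
        refine IntermediateField.adjoin.mono _ _ _ ?_
        rintro _ ⟨h, rfl⟩
        exact ⟨Sum.inr h, rfl⟩
      rw [eq_top_iff, ← (RatFunField.isPureBasis_x K H).2, IntermediateField.adjoin_le_iff]
      rintro _ ⟨h, rfl⟩
      rw [← projVar_mul_varSum]
      exact mul_mem (h2 (projVar_mem h)) (IntermediateField.subset_adjoin _ _ ⟨Sum.inl (), rfl⟩)
    · rw [Nat.card_sum, Nat.card_unique, add_comm, card_ne_one_add_one]
  have h2 := IntermediateField.algebraicIndependent_adjoin_iff.2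
    (AlgebraicIndependent.sumElim_iff.1 h1.1).2
  rwa [← projField_eq_adjoin] at h2

/-- Each x(h) is `s` times an element of `projField K H`, so that field spans everything over `F`.
Averaging against an element of trace one that also lies in it keeps the averages inside it. -/
theorem noetherField_le_adjoin :
    NoetherField K H ≤ IntermediateField.adjoin K
      ((projField K H ⊓ NoetherField K H : IntermediateField K (RatFunField K H)) ∪
        {varSum K H}) := by
  set F := IntermediateField.adjoin K
      ((projField K H ⊓ NoetherField K H : IntermediateField K (RatFunField K H)) ∪
        {varSum K H} : Set (RatFunField K H))
  obtain ⟨c, hc, hc1⟩ := exists_sum_eq_one (regularAction K H) eq_one_of_regularAction_projVar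
  rw [range_regularAction_projVar] at hc
  have hs : varSum K H ∈ F := IntermediateField.subset_adjoin _ _ (Or.inr rfl)
  have hle : ∀ a ∈ projField K H, a ∈ NoetherField K H → a ∈ F := fun a h1 h2 =>
    IntermediateField.subset_adjoin _ _ (Or.inl ⟨h1, h2⟩)
  refine fixedField_le_of_span_eq_top _ (span_mul_eq_top (F := F)
    (projField K H).toSubmonoid ⊥ (fun a ha => ?_) (fun b hb => ?_) ?_) hc1 ?_ ?_
  · exact isAlgebraic_of_fixedField_le (regularAction K H) (E := projField K H)
      (fun a ha h => regularAction_mem_projField ha h) (AlgHom.id K _) hle ha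
  · rw [Submonoid.mem_bot.1 hb]
    exact isAlgebraic_one
  · set A := IntermediateField.adjoin F
      (((projField K H).toSubmonoid : Set (RatFunField K H)) ∪ (⊥ : Submonoid (RatFunField K H)))
    have h2 : IntermediateField.adjoin K (Set.range (RatFunField.x K)) ≤ A.restrictScalars K := by
      refine IntermediateField.adjoin_le_iff.2 ?_
      rintro _ ⟨h, rfl⟩
      rw [← projVar_mul_varSum]
      exact mul_mem (IntermediateField.subset_adjoin F _ (Or.inl (projVar_mem h)))
        (A.algebraMap_mem ⟨_, hs⟩)
    rw [(RatFunField.isPureBasis_x K H).2] at h2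
    exact eq_top_iff.2 fun a _ => h2 (IntermediateField.mem_top (x := a))
  · have h3 : F ≤ NoetherField K H := by
      refine IntermediateField.adjoin_le_iff.2 ?_
      rintro a (ha | rfl)
      exacts [ha.2, varSum_mem_noetherField]
    exact fun a ha => (mem_fixedField_range _).1 (h3 ha)
  · rintro _ ⟨a, ha, b, hb, rfl⟩
    rw [Submonoid.mem_bot.1 hb, mul_one]
    exact hle _ (sum_mem fun h _ => regularAction_mem_projField (mul_mem ha hc) h)
      (sum_mem_fixedField _ _)

variable (K H) in
/-- The invariants in the field generated by the quotients of the variables. -/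
def projNoetherField : IntermediateField K (NoetherField K H) :=
  (projField K H).comap (NoetherField K H).val

/-- This is K(H) = L(s): the role of `s` can later be given to any element transcendental over `L`.
-/
theorem isPureBasis_varSum :
    IsPureBasis (projNoetherField K H)
      (fun _ : Unit => (⟨varSum K H, varSum_mem_noetherField⟩ : NoetherField K H)) := by
  refine ⟨?_, ?_⟩
  · let f : projNoetherField K H →+* projField K H :=
      ((algebraMap (NoetherField K H) (RatFunField K H)).comp
        (algebraMap (projNoetherField K H) (NoetherField K H))).codRestrict _ fun a => a.2
    exact AlgebraicIndependent.of_ringHom_of_comp_eq f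
      (algebraMap (NoetherField K H) (RatFunField K H))
      algebraicIndependent_projField_varSum f.injective rfl
  · set B := IntermediateField.adjoin (projNoetherField K H)
      (Set.range (fun _ : Unit => (⟨varSum K H, varSum_mem_noetherField⟩ : NoetherField K H)))
    let C : IntermediateField K (RatFunField K H) :=
      (B.restrictScalars K).map (NoetherField K H).val
    have hC : ∀ b : NoetherField K H, b ∈ B → (b : RatFunField K H) ∈ C := fun b hb => ⟨b, hb, rfl⟩
    have h1 : NoetherField K H ≤ C := by
      refine noetherField_le_adjoin.trans (IntermediateField.adjoin_le_iff.2 ?_)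
      rintro a (ha | rfl)
      · have hb : (⟨a, ha.2⟩ : NoetherField K H) ∈ B :=
          B.algebraMap_mem (⟨⟨a, ha.2⟩, ha.1⟩ : projNoetherField K H)
        exact hC _ hb
      · exact hC ⟨varSum K H, varSum_mem_noetherField⟩
          (IntermediateField.subset_adjoin _ _ ⟨(), rfl⟩)
    refine eq_top_iff.2 fun a _ => ?_
    obtain ⟨b, hb, hba⟩ := h1 a.2
    rwa [← Subtype.ext hba]

theorem trdeg_noetherField : Algebra.trdeg K (NoetherField K H) = (Nat.card H : ℕ) := by
  have : Algebra.IsAlgebraic (NoetherField K H) (RatFunField K H) := ⟨fun a =>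
    isAlgebraic_of_fixedField_le (regularAction K H) (E := ⊤) (fun _ _ _ => trivial)
      (AlgHom.id K _) (fun a _ ha => ha) (a := a) trivial⟩
  refine trdeg_tower_cancel' (M := RatFunField K H) (b := 0) ?_ ?_
  · rw [trdeg_eq_zero, Nat.cast_zero]
  · exact (RatFunField.isPureBasis_x K H).trdeg_eq

theorem trdeg_projNoetherField :
    Algebra.trdeg K (projNoetherField K H) = (Nat.card {h : H // h ≠ 1} : ℕ) := by
  refine trdeg_tower_cancel' (M := NoetherField K H) isPureBasis_varSum.trdeg_eq ?_
  rw [trdeg_noetherField, Nat.card_unique (α := Unit), card_ne_one_add_one]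

end Proj

end

noncomputable section

/-! ### Invariant generators of K(x(h,g)) and of K(H × G) -/

section Product

variable (K H G : Type*) [Field K] [Group H] [Group G] [Fintype H] [Fintype G]
  [DecidableEq H] [DecidableEq G]

omit [Fintype H] [Fintype G] [DecidableEq H] [DecidableEq G] in
theorem MonoidHom.fst_surjective : Function.Surjective (MonoidHom.fst H G) :=
  fun h => ⟨(h, 1), rfl⟩

omit [Fintype H] [Fintype G] [DecidableEq H] [DecidableEq G] in
theorem MonoidHom.snd_surjective : Function.Surjective (MonoidHom.snd H G) :=
  fun g => ⟨(1, g), rfl⟩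

/-- The embedding `K(x(h) : h ∈ H) → K(x(h, g) : (h, g) ∈ H × G)` with `x(h) ↦ ∑ g, x(h, g)`. -/
def fiberSumFst : RatFunField K H →ₐ[K] RatFunField K (H × G) :=
  fiberSum K (MonoidHom.fst_surjective H G)

/-- The embedding `K(x(g) : g ∈ G) → K(x(h, g) : (h, g) ∈ H × G)` with `x(g) ↦ ∑ h, x(h, g)`. -/
def fiberSumSnd : RatFunField K G →ₐ[K] RatFunField K (H × G) :=
  fiberSum K (MonoidHom.snd_surjective H G)

variable {H} in
omit [DecidableEq G] in
theorem fiberSumFst_x (h : H) :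
    fiberSumFst K H G (RatFunField.x K h) = ∑ g : G, RatFunField.x K (h, g) := by
  rw [fiberSumFst, fiberSum_x]
  refine Finset.sum_bij' (fun p _ => p.2) (fun g _ => (h, g)) ?_ ?_ ?_ ?_ ?_
  all_goals simp +contextual [eq_comm]

variable {G} in
omit [DecidableEq H] in
theorem fiberSumSnd_x (g : G) :
    fiberSumSnd K H G (RatFunField.x K g) = ∑ h : H, RatFunField.x K (h, g) := by
  rw [fiberSumSnd, fiberSum_x]
  refine Finset.sum_bij' (fun p _ => p.1) (fun h _ => (h, g)) ?_ ?_ ?_ ?_ ?_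
  all_goals simp +contextual [eq_comm]

variable {K H G}

omit [DecidableEq G] in
theorem regularAction_fiberSumFst (p : H × G) (a : RatFunField K H) :
    regularAction K (H × G) p (fiberSumFst K H G a) =
      fiberSumFst K H G (regularAction K H p.1 a) :=
  regularAction_fiberSum _ p a

omit [DecidableEq H] in
theorem regularAction_fiberSumSnd (p : H × G) (a : RatFunField K G) :
    regularAction K (H × G) p (fiberSumSnd K H G a) =
      fiberSumSnd K H G (regularAction K G p.2 a) :=
  regularAction_fiberSum _ p a

/-- Both sides are the sum of all x(h,g). Because of this coincidence only the quotients x(h)/s,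
rather than the x(h), are adjoined to the image of K(x(g)). -/
theorem fiberSumFst_varSum :
    fiberSumFst K H G (varSum K H) = fiberSumSnd K H G (varSum K G) := by
  simp_rw [varSum, map_sum, fiberSumFst_x, fiberSumSnd_x]
  exact Finset.sum_comm

variable (K H G) in
/-- The field generated by `x(h) / ∑ k, x(k)` and `x(g)` inside `K(x(h, g))`. -/
def fiberField : IntermediateField K (RatFunField K (H × G)) :=
  (projField K H).map (fiberSumFst K H G) ⊔ (fiberSumSnd K H G).fieldRange

theorem fiberSumFst_mem_fiberField {a : RatFunField K H} (ha : a ∈ projField K H) :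
    fiberSumFst K H G a ∈ fiberField K H G :=
  (le_sup_left : _ ≤ fiberField K H G) ⟨a, ha, rfl⟩

theorem fiberSumSnd_mem_fiberField (a : RatFunField K G) :
    fiberSumSnd K H G a ∈ fiberField K H G :=
  (le_sup_right : _ ≤ fiberField K H G) ⟨a, rfl⟩

theorem fiberSumFst_x_mem_fiberField (h : H) :
    fiberSumFst K H G (RatFunField.x K h) ∈ fiberField K H G := by
  rw [← projVar_mul_varSum, map_mul, fiberSumFst_varSum]
  exact mul_mem (fiberSumFst_mem_fiberField (projVar_mem h)) (fiberSumSnd_mem_fiberField _)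

variable (K H G) in
/-- The invariants `∑ (h, g), (x(h) / ∑ k, x(k)) ^ i * x(g) ^ j * x(h, g)`. -/
def powerTrace (i j : ℕ) : RatFunField K (H × G) :=
  ∑ p : H × G, fiberSumFst K H G (projVar K p.1) ^ i * fiberSumSnd K H G (RatFunField.x K p.2) ^ j *
    RatFunField.x K p

theorem powerTrace_mem_noetherField (i j : ℕ) :
    powerTrace K H G i j ∈ NoetherField K (H × G) := by
  refine (mem_fixedField_range _).2 fun p => ?_
  rw [powerTrace, map_sum]
  refine Fintype.sum_equiv (Equiv.mulLeft p) _ _ fun q => ?_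
  rw [map_mul, map_mul, map_pow, map_pow, regularAction_fiberSumFst, regularAction_fiberSumSnd,
    regularAction_projVar, regularAction_x, regularAction_x]
  rfl

omit [Fintype G] [DecidableEq G] in
theorem eq_one_of_regularAction_x (g : G)
    (hg : regularAction K G g (RatFunField.x K 1) = RatFunField.x K 1) : g = 1 := by
  rw [regularAction_x, mul_one] at hg
  exact RatFunField.x_injective hg

/-- The product of the interpolation identities for `H` and `G` is a combination of the coefficients
of `powerTrace` that vanishes on every x(q) except x(p). -/
theorem x_mem_span_powerTrace (p : H × G) :
    RatFunField.x K p ∈ Submodule.span (fiberField K H G)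
      (Set.range fun q : Fin (Fintype.card H) × Fin (Fintype.card G) =>
        powerTrace K H G q.1 q.2) := by
  obtain ⟨a, ha, ha'⟩ := sum_sum_pow_eq_ite (regularAction K H) eq_one_of_regularAction_projVar p.1
  obtain ⟨b, -, hb'⟩ := sum_sum_pow_eq_ite (regularAction K G) eq_one_of_regularAction_x p.2
  rw [range_regularAction_projVar] at ha
  simp_rw [regularAction_projVar, mul_one] at ha'
  simp_rw [regularAction_x, mul_one] at hb'
  have h1 : RatFunField.x K p = ∑ i ∈ Finset.range (Fintype.card H),
      ∑ j ∈ Finset.range (Fintype.card G),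
        (fiberSumFst K H G (a i) * fiberSumSnd K H G (b j)) * powerTrace K H G i j := by
    have h2 : ∀ q : H × G,
        (∑ i ∈ Finset.range (Fintype.card H), ∑ j ∈ Finset.range (Fintype.card G),
          (fiberSumFst K H G (a i) * fiberSumSnd K H G (b j)) *
          (fiberSumFst K H G (projVar K q.1) ^ i * fiberSumSnd K H G (RatFunField.x K q.2) ^ j *
            RatFunField.x K q)) = if q = p then RatFunField.x K q else 0 := by
      intro q
      have h3 := congrArg₂ (· * ·) (congrArg (fiberSumFst K H G) (ha' q.1))
        (congrArg (fiberSumSnd K H G) (hb' q.2))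
      simp only [map_sum, map_mul, map_pow, Finset.sum_mul_sum] at h3
      have h4 := congrArg (· * RatFunField.x K q) h3
      simp only [Finset.sum_mul] at h4
      refine (Finset.sum_congr rfl fun i _ => Finset.sum_congr rfl fun j _ => ?_).trans
        (h4.trans ?_)
      · ring
      · by_cases h5 : q.1 = p.1 <;> by_cases h6 : q.2 = p.2 <;> simp [Prod.ext_iff, h5, h6]
    simp_rw [powerTrace, Finset.mul_sum]
    rw [eq_comm]
    calc _ = ∑ i ∈ Finset.range (Fintype.card H), ∑ q : H × G,
          ∑ j ∈ Finset.range (Fintype.card G), _ :=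
          Finset.sum_congr rfl fun i _ => Finset.sum_comm
      _ = ∑ q : H × G, ∑ i ∈ Finset.range (Fintype.card H),
          ∑ j ∈ Finset.range (Fintype.card G), _ := Finset.sum_comm
      _ = _ := by
        rw [Finset.sum_congr rfl fun q _ => h2 q]
        simp
  rw [h1]
  refine Submodule.sum_mem _ fun i hi => Submodule.sum_mem _ fun j hj => ?_
  exact Submodule.smul_mem _ (⟨_, mul_mem (fiberSumFst_mem_fiberField (ha i))
    (fiberSumSnd_mem_fiberField (b j))⟩ : fiberField K H G) (Submodule.subset_span
      ⟨(⟨i, Finset.mem_range.1 hi⟩, ⟨j, Finset.mem_range.1 hj⟩), rfl⟩)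

theorem powerTrace_mem_span_x (i j : ℕ) :
    powerTrace K H G i j ∈ Submodule.span (fiberField K H G)
      (Set.range (RatFunField.x K : H × G → RatFunField K (H × G))) :=
  Submodule.sum_mem _ fun p _ => Submodule.smul_mem _
    (⟨_, mul_mem (pow_mem (fiberSumFst_mem_fiberField (projVar_mem p.1)) i)
      (pow_mem (fiberSumSnd_mem_fiberField (RatFunField.x K p.2)) j)⟩ : fiberField K H G)
      (Submodule.subset_span ⟨p, rfl⟩)

/-- Row and column sums lie in `fiberField`, so the variables with h = 1 or g = 1 are determined by
the others up to that field. This bounds the dimension by (|H|-1)(|G|-1) + 1. -/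
theorem x_mem_span_option (p : H × G) :
    RatFunField.x K p ∈ Submodule.span (fiberField K H G)
      (Set.range fun o : Option ({h : H // h ≠ 1} × {g : G // g ≠ 1}) =>
        o.elim (1 : RatFunField K (H × G)) fun q => RatFunField.x K (q.1.1, q.2.1)) := by
  set W := Submodule.span (fiberField K H G)
      (Set.range fun o : Option ({h : H // h ≠ 1} × {g : G // g ≠ 1}) =>
        o.elim (1 : RatFunField K (H × G)) fun q => RatFunField.x K (q.1.1, q.2.1))
  have h0 : ∀ a ∈ fiberField K H G, a ∈ W := fun a ha => by
    have := W.smul_mem (⟨a, ha⟩ : fiberField K H G) (Submodule.subset_span ⟨none, rfl⟩)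
    rw [IntermediateField.smul_def] at this
    simpa using this
  have h1 : ∀ h : H, h ≠ 1 → ∀ g : G, g ≠ 1 → RatFunField.x K (h, g) ∈ W := fun h hh g hg =>
    Submodule.subset_span ⟨some (⟨h, hh⟩, ⟨g, hg⟩), rfl⟩
  have h2 : ∀ h : H, h ≠ 1 → ∀ g : G, RatFunField.x K (h, g) ∈ W := by
    intro h hh g
    by_cases hg : g = 1
    · have h3 := fiberSumFst_x K G h
      rw [Fintype.sum_eq_add_sum_subtype_ne _ (1 : G), ← sub_eq_iff_eq_add] at h3
      rw [hg, ← h3]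
      exact W.sub_mem (h0 _ (fiberSumFst_x_mem_fiberField h))
        (W.sum_mem fun g' _ => h1 h hh g'.1 g'.2)
    · exact h1 h hh g hg
  obtain ⟨h, g⟩ := p
  by_cases hh : h = 1
  · have h3 := fiberSumSnd_x K H g
    rw [Fintype.sum_eq_add_sum_subtype_ne _ (1 : H), ← sub_eq_iff_eq_add] at h3
    rw [hh, ← h3]
    exact W.sub_mem (h0 _ (fiberSumSnd_mem_fiberField _)) (W.sum_mem fun h' _ => h2 h'.1 h'.2 g)
  · exact h2 h hh g

variable (K H G) in
/-- The rational function field `K(x(h, g))` has a basis over `K` that consists of the quotients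
`x(h) / ∑ k, x(k)` for `h ≠ 1`, the `x(g)` and invariant elements. -/
theorem exists_isPureBasis_invariants :
    ∃ Z : Set (RatFunField K (H × G)), Finite Z ∧ (∀ z ∈ Z, z ∈ NoetherField K (H × G)) ∧
      IsPureBasis K (Sum.elim (Sum.elim (fun g => fiberSumSnd K H G (RatFunField.x K g))
        (fun z : Z => z.1)) (fun h : {h : H // h ≠ 1} => fiberSumFst K H G (projVar K h.1))) := by
  set t : Set (RatFunField K (H × G)) :=
    {1} ∪ Set.range fun q : Fin (Fintype.card H) × Fin (Fintype.card G) =>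
      powerTrace K H G q.1 q.2 with ht
  have htfin : t.Finite := (Set.finite_singleton _).union (Set.finite_range _)
  -- The basis is made to contain 1, which generates nothing new as a field element; dropping it
  -- saves the one element that the final count requires.
  obtain ⟨b, hbt, h1b, htb, hb⟩ := exists_linearIndepOn_id_extension (K := fiberField K H G)
    (s := {(1 : RatFunField K (H × G))}) (t := t)
    (LinearIndepOn.singleton (v := id) one_ne_zero) Set.subset_union_left
  have hbfin : Finite b := htfin.subset hbt
  refine ⟨b \ {1}, (htfin.subset hbt).subset Set.sdiff_subset, ?_, ?_⟩
  · rintro z ⟨hz, hz1⟩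
    rcases hbt hz with h | ⟨q, rfl⟩
    exacts [(hz1 h).elim, powerTrace_mem_noetherField _ _]
  have hcard : Nat.card b ≤ Nat.card {h : H // h ≠ 1} * Nat.card {g : G // g ≠ 1} + 1 := by
    classical
    have h1 := linearIndependent_le_span' (R := fiberField K H G) (fun z : b => z.1) hb
      (Set.range fun o : Option ({h : H // h ≠ 1} × {g : G // g ≠ 1}) =>
        o.elim (1 : RatFunField K (H × G)) fun q => RatFunField.x K (q.1.1, q.2.1)) (by
      rintro _ ⟨z, rfl⟩
      change z.1 ∈ Submodule.span _ _
      rcases hbt z.2 with h | ⟨q, hq⟩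
      · rw [Set.mem_singleton_iff.1 h]
        exact Submodule.subset_span ⟨none, rfl⟩
      · rw [← hq]
        refine Submodule.span_le.2 ?_ (powerTrace_mem_span_x q.1 q.2)
        rintro _ ⟨p, rfl⟩
        exact x_mem_span_option p)
    rw [← Nat.cast_card, Nat.cast_le, ← Nat.card_eq_fintype_card] at h1
    refine h1.trans ((Finite.card_range_le _).trans ?_)
    rw [Finite.card_option, Nat.card_prod]
  refine isPureBasis_of_card_le (RatFunField.isPureBasis_x K (H × G)).trdeg_eq ?_ ?_
  · set A := IntermediateField.adjoin K (Set.range (Sum.elim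
      (Sum.elim (fun g => fiberSumSnd K H G (RatFunField.x K g)) (fun z : ↥(b \ {1}) => z.1))
      (fun h : {h : H // h ≠ 1} => fiberSumFst K H G (projVar K h.1))))
    have h1 : fiberField K H G ≤ A := by
      refine sup_le ?_ ?_
      · rw [projField_eq_adjoin, IntermediateField.adjoin_map, IntermediateField.adjoin_le_iff]
        rintro _ ⟨_, ⟨h, rfl⟩, rfl⟩
        exact IntermediateField.subset_adjoin _ _ ⟨Sum.inr h, rfl⟩
      · rintro _ ⟨a, rfl⟩
        refine IntermediateField.map_mem_adjoin_of_adjoin_eq_top (RatFunField.isPureBasis_x K G).2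
          (fiberSumSnd K H G) A ?_ a
        rintro _ ⟨g, rfl⟩
        exact IntermediateField.subset_adjoin _ _ ⟨Sum.inl (Sum.inl g), rfl⟩
    have h2 : b ⊆ A := fun z hz => by
      by_cases hz1 : z = 1
      · rw [hz1]; exact one_mem A
      · exact IntermediateField.subset_adjoin _ _ ⟨Sum.inl (Sum.inr ⟨z, hz, hz1⟩), rfl⟩
    have h3 : ∀ a ∈ Submodule.span (fiberField K H G) b, a ∈ A := by
      intro a ha
      induction ha using Submodule.span_induction with
      | mem a ha => exact h2 ha
      | zero => exact zero_mem A
      | add a a' _ _ ha ha' => exact add_mem ha ha'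
      | smul c a _ ha => exact mul_mem (h1 c.2) ha
    rw [eq_top_iff, ← (RatFunField.isPureBasis_x K (H × G)).2, IntermediateField.adjoin_le_iff]
    rintro _ ⟨p, rfl⟩
    refine h3 _ (Submodule.span_le.2 ?_ (x_mem_span_powerTrace p))
    exact Set.subset_union_right.trans htb
  · have h1 : Nat.card (b \ {1} : Set _) + 1 = Nat.card b := by
      rw [Nat.card_coe_set_eq, Nat.card_coe_set_eq]
      exact Set.ncard_sdiff_singleton_add_one (h1b rfl) hbfin
    have h2 := card_ne_one_add_one (H := H)
    have h3 := card_ne_one_add_one (H := G)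
    rw [Nat.card_sum, Nat.card_sum, Nat.card_prod, ← h2, ← h3]
    nlinarith

/-- Over `F`, which contains `Z`, everything is spanned by products of an element from the `H` side
and one from the `G` side. With a trace-one element of the form c·d, the trace of such a product
factors into a trace for `H` and one for `G`. -/
theorem noetherField_prod_le_adjoin {Z : Set (RatFunField K (H × G))}
    (hZ : ∀ z ∈ Z, z ∈ NoetherField K (H × G))
    (hgen : IsPureBasis K (Sum.elim (Sum.elim (fun g => fiberSumSnd K H G (RatFunField.x K g))
        (fun z : Z => z.1)) (fun h : {h : H // h ≠ 1} => fiberSumFst K H G (projVar K h.1)))) :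
    NoetherField K (H × G) ≤ IntermediateField.adjoin K
      ((fiberSumFst K H G '' {a | a ∈ projField K H ∧ a ∈ NoetherField K H} ∪
        fiberSumSnd K H G '' {b | b ∈ NoetherField K G}) ∪ Z) := by
  set F := IntermediateField.adjoin K
      ((fiberSumFst K H G '' {a | a ∈ projField K H ∧ a ∈ NoetherField K H} ∪
        fiberSumSnd K H G '' {b | b ∈ NoetherField K G}) ∪ Z)
  have hFH : ∀ a ∈ projField K H, a ∈ NoetherField K H → fiberSumFst K H G a ∈ F :=
    fun a h1 h2 => IntermediateField.subset_adjoin _ _ (Or.inl (Or.inl ⟨a, ⟨h1, h2⟩, rfl⟩))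
  have hFG : ∀ b ∈ NoetherField K G, fiberSumSnd K H G b ∈ F :=
    fun b h1 => IntermediateField.subset_adjoin _ _ (Or.inl (Or.inr ⟨b, h1, rfl⟩))
  obtain ⟨c, hc, hc1⟩ := exists_sum_eq_one (regularAction K H) eq_one_of_regularAction_projVar
  obtain ⟨d, -, hd1⟩ := exists_sum_eq_one (regularAction K G) eq_one_of_regularAction_x
  rw [range_regularAction_projVar] at hc
  have hsum : ∀ a b, ∑ p, regularAction K (H × G) p (fiberSumFst K H G a * fiberSumSnd K H G b) =
      fiberSumFst K H G (∑ h, regularAction K H h a) *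
        fiberSumSnd K H G (∑ g, regularAction K G g b) := by
    intro a b
    rw [map_sum, map_sum, Finset.sum_mul_sum, Fintype.sum_prod_type]
    refine Finset.sum_congr rfl fun h _ => Finset.sum_congr rfl fun g _ => ?_
    rw [map_mul, regularAction_fiberSumFst, regularAction_fiberSumSnd]
  refine fixedField_le_of_span_eq_top _ (c := fiberSumFst K H G c * fiberSumSnd K H G d)
    (span_mul_eq_top (F := F) ((projField K H).map (fiberSumFst K H G)).toSubmonoid
      (fiberSumSnd K H G).fieldRange.toSubmonoid ?_ ?_ ?_) ?_ ?_ ?_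
  · rintro _ ⟨a, ha, rfl⟩
    exact isAlgebraic_of_fixedField_le (regularAction K H) (E := projField K H)
      (fun a ha h => regularAction_mem_projField ha h) (fiberSumFst K H G) hFH ha
  · rintro _ ⟨b, rfl⟩
    exact isAlgebraic_of_fixedField_le (regularAction K G) (E := ⊤)
      (fun _ _ _ => trivial) (fiberSumSnd K H G) (fun b _ hb => hFG b hb) (a := b) trivial
  · set A := IntermediateField.adjoin F
      ((((projField K H).map (fiberSumFst K H G)).toSubmonoid : Set (RatFunField K (H × G))) ∪
        (fiberSumSnd K H G).fieldRange.toSubmonoid)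
    have h1 : IntermediateField.adjoin K (Set.range
        (Sum.elim (Sum.elim (fun g => fiberSumSnd K H G (RatFunField.x K g))
        (fun z : Z => z.1)) (fun h : {h : H // h ≠ 1} => fiberSumFst K H G (projVar K h.1)))) ≤
        A.restrictScalars K := by
      refine IntermediateField.adjoin_le_iff.2 ?_
      rintro _ ⟨(g | z) | h, rfl⟩
      · exact IntermediateField.subset_adjoin F _ (Or.inr ⟨_, rfl⟩)
      · exact A.algebraMap_mem ⟨z.1, IntermediateField.subset_adjoin _ _ (Or.inr z.2)⟩
      · exact IntermediateField.subset_adjoin F _ (Or.inl ⟨_, projVar_mem _, rfl⟩)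
    rw [hgen.2] at h1
    exact eq_top_iff.2 fun a _ => h1 (IntermediateField.mem_top (x := a))
  · rw [hsum, hc1, hd1, map_one, map_one, mul_one]
  · have h3 : F ≤ NoetherField K (H × G) := by
      refine IntermediateField.adjoin_le_iff.2 ?_
      rintro _ ((⟨a, ha, rfl⟩ | ⟨b, hb, rfl⟩) | hz)
      exacts [fiberSum_mem_noetherField _ ha.2, fiberSum_mem_noetherField _ hb, hZ _ hz]
    exact fun a ha => (mem_fixedField_range _).1 (h3 ha)
  · rintro _ ⟨_, ⟨a, ha, rfl⟩, _, ⟨b, rfl⟩, rfl⟩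
    have h4 := hsum (a * c) (b * d)
    rw [map_mul, map_mul, mul_mul_mul_comm] at h4
    refine (congrArg (· ∈ F) h4).mpr (mul_mem (hFH _ (sum_mem fun h _ =>
      regularAction_mem_projField (mul_mem ha hc) h) (sum_mem_fixedField _ _)) (hFG _
        (sum_mem_fixedField _ _)))

end Product

end

/-! ### Choice of the embedding and conclusion -/

noncomputable section

/-- A rational function field in one variable embeds into every rational extension of positive
transcendence degree in such a way that the extension stays rational over it. -/
theorem exists_algHom_isRationalExt {K F N ι : Type*} [Field K] [Field F] [Field N] [Algebra K F]
    [Algebra K N] [Unique ι] {s : ι → F} (hs : IsPureBasis K s) (hN : IsRationalExt K N)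
    (h0 : Algebra.trdeg K N ≠ 0) :
    ∃ φ : F →ₐ[K] N, @IsRationalExt F N _ _ φ.toRingHom.toAlgebra := by
  classical
  obtain ⟨n, b, hb⟩ := isRationalExt_iff.1 hN
  have hn := hb.trdeg_eq
  rw [Nat.card_fin] at hn
  cases n with
  | zero => exact (h0 (by rw [hn, Nat.cast_zero])).elim
  | succ n =>
    obtain ⟨φ, hφ⟩ := hs.exists_algHom (y := fun _ : ι => b 0)
      (hb.1.comp (fun _ : ι => 0) fun i j _ => Subsingleton.elim i j)
    let _ : Algebra F N := φ.toRingHom.toAlgebra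
    have : IsScalarTower K F N := IsScalarTower.of_algebraMap_eq fun k => (φ.commutes k).symm
    refine ⟨φ, IsPureBasis.isRationalExt (x := b ∘ Fin.succ) (isPureBasis_of_card_le (n := n)
      (trdeg_tower_cancel hs.trdeg_eq ?_) ?_ (Nat.card_fin n).le)⟩
    · rw [hn, Nat.card_unique, add_comm]
    · set A := IntermediateField.adjoin F (Set.range (b ∘ Fin.succ))
      have h1 : IntermediateField.adjoin K (Set.range b) ≤ A.restrictScalars K := by
        refine IntermediateField.adjoin_le_iff.2 ?_
        rintro _ ⟨i, rfl⟩
        refine Fin.cases ?_ (fun i => ?_) i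
        · exact hφ default ▸ A.algebraMap_mem (s default)
        · exact IntermediateField.subset_adjoin F _ ⟨i, rfl⟩
      rw [hb.2] at h1
      exact eq_top_iff.2 fun a _ => h1 (IntermediateField.mem_top (x := a))

theorem IsRationalExt.of_surjective {F N : Type*} [Field F] [Field N] [Algebra F N]
    (h : Function.Surjective (algebraMap F N)) : IsRationalExt F N :=
  isRationalExt_iff.2 ⟨0, Fin.elim0, by
    have : Algebra.IsAlgebraic F N := ⟨fun a => (h a).elim fun b hb => hb ▸ isAlgebraic_algebraMap b⟩
    refine isPureBasis_of_card_le (n := 0) (by rw [trdeg_eq_zero, Nat.cast_zero]) ?_ (by simp)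
    refine eq_top_iff.2 fun a _ => ?_
    obtain ⟨a, rfl⟩ := h a
    exact IntermediateField.algebraMap_mem _ a⟩

theorem IsRationalExt.of_algEquiv {K L M : Type*} [Field K] [Field L] [Field M] [Algebra K L]
    [Algebra K M] (e : L ≃ₐ[K] M) : IsRationalExt K L → IsRationalExt K M
  | ⟨n, ⟨f⟩⟩ => ⟨n, ⟨e.symm.trans f⟩⟩

theorem exists_isPureBasis_noetherField (K G : Type*) [Field K] [Group G] [Subsingleton G] :
    ∃ s : G → NoetherField K G, IsPureBasis K s := by
  have h : NoetherField K G = ⊤ := eq_top_iff.2 fun a _ => (mem_fixedField_range _).2 fun g => by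
    rw [Subsingleton.elim g 1, map_one, AlgEquiv.one_apply]
  exact ⟨_, (RatFunField.isPureBasis_x K G).map_algEquiv
    ((IntermediateField.equivOfEq h).trans IntermediateField.topEquiv).symm⟩

section BaseChange

variable {K Q F N M ι κ μ : Type*} [Field K] [Field Q] [Field F] [Field N] [Field M] [Finite κ]
  [Algebra K Q] [Algebra K F] [Algebra K N] [Algebra K M] [Algebra N M] [IsScalarTower K N M]

/-- One independent family over `K` feeds all three base changes: `F` lies in K(y) and `L` in K(x),
so `y` and `z` are independent over `L`. -/
theorem isRationalExt_of_algHom (φ : F →ₐ[K] N) (ψ : Q →ₐ[K] N) (L : IntermediateField K Q)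
    {s : Q} (hs : IsPureBasis L (fun _ : Unit => s)) {x : μ → M} {y : ι → M} {z : κ → N}
    (hb : AlgebraicIndependent K (Sum.elim (Sum.elim y (algebraMap N M ∘ z)) x))
    (hx : ∀ a ∈ L, algebraMap N M (ψ a) ∈ IntermediateField.adjoin K (Set.range x))
    (hy : ∀ a, algebraMap N M (φ a) ∈ IntermediateField.adjoin K (Set.range y))
    (hgen : ∀ B : IntermediateField K N, (∀ a ∈ L, ψ a ∈ B) → (∀ a, φ a ∈ B) → (∀ k, z k ∈ B) →
      B = ⊤)
    {a b : ℕ} (hF : Algebra.trdeg K F = a) (hL : Algebra.trdeg K L = b)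
    (hN : Algebra.trdeg K N = (a + (b + Nat.card κ) : ℕ)) :
    letI : Algebra F N := φ.toRingHom.toAlgebra
    (Nonempty κ → IsRationalExt K Q → IsRationalExt F N) ∧
    (IsStablyRationalExt K Q → IsStablyRationalExt F N) ∧
    (IsRetractRationalExt K Q → IsRetractRationalExt F N) := by
  let _ : Algebra F N := φ.toRingHom.toAlgebra
  let _ : Algebra Q N := ψ.toRingHom.toAlgebra
  have : IsScalarTower K F N := IsScalarTower.of_algebraMap_eq fun k => (φ.commutes k).symm
  have : IsScalarTower K Q N := IsScalarTower.of_algebraMap_eq fun k => (ψ.commutes k).symm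
  let _ : Algebra L M := ((algebraMap N M).comp (algebraMap L N)).toAlgebra
  have : IsScalarTower L N M := IsScalarTower.of_algebraMap_eq fun _ => rfl
  let _ : Algebra F M := ((algebraMap N M).comp (algebraMap F N)).toAlgebra
  have : IsScalarTower F N M := IsScalarTower.of_algebraMap_eq fun _ => rfl
  have : IsScalarTower K L M := IsScalarTower.of_algebraMap_eq fun k => by
    rw [IsScalarTower.algebraMap_apply L N M, ← IsScalarTower.algebraMap_apply K L N,
      ← IsScalarTower.algebraMap_apply K N M]
  have hLM : ∀ a : L, algebraMap L M a ∈ IntermediateField.adjoin K (Set.range x) :=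
    fun a => hx a a.2
  have hyz : AlgebraicIndependent L (Sum.elim y (algebraMap N M ∘ z)) := by
    have h := IntermediateField.algebraicIndependent_adjoin_iff.2
      (AlgebraicIndependent.sumElim_iff.1 hb).2
    let f : L →+* IntermediateField.adjoin K (Set.range x) := (algebraMap L M).codRestrict _ hLM
    exact AlgebraicIndependent.of_ringHom_of_comp_eq f (RingHom.id M) h f.injective rfl
  have hz : AlgebraicIndependent L z :=
    AlgebraicIndependent.of_ringHom_of_comp_eq (RingHom.id L) (algebraMap N M)
      (hyz.comp Sum.inr Sum.inr_injective) Function.injective_id rfl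
  have hgen' : IntermediateField.adjoin F (Set.range (algebraMap L N) ∪ Set.range z) = ⊤ := by
    have h := hgen ((IntermediateField.adjoin F
      (Set.range (algebraMap L N) ∪ Set.range z)).restrictScalars K)
      (fun a ha => IntermediateField.subset_adjoin F _ (Or.inl ⟨⟨a, ha⟩, rfl⟩))
      (fun a => IntermediateField.algebraMap_mem _ a)
      (fun k => IntermediateField.subset_adjoin F _ (Or.inr ⟨k, rfl⟩))
    exact eq_top_iff.2 fun a _ => h.ge (IntermediateField.mem_top (x := a))
  have hFN := trdeg_tower_cancel hF hN
  exact ⟨fun _ h => isRationalExt_of_adjoin_eq_top hs hz hgen' hL hFN h,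
    fun h => isStablyRationalExt_of_adjoin_eq_top hs hgen' hL hFN h,
    fun h => isRetractRationalExt_of_adjoin_eq_top hyz hy hgen' h⟩

omit [Finite κ] in
theorem isRationalExt_trans_of_algHom (φ : F →ₐ[K] N) :
    letI : Algebra F N := φ.toRingHom.toAlgebra
    (IsRationalExt K F → IsRationalExt F N → IsRationalExt K N) ∧
    (IsStablyRationalExt K F → IsStablyRationalExt F N → IsStablyRationalExt K N) ∧
    (IsRetractRationalExt K F → IsRetractRationalExt F N → IsRetractRationalExt K N) := by
  let _ : Algebra F N := φ.toRingHom.toAlgebra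
  have : IsScalarTower K F N := IsScalarTower.of_algebraMap_eq fun k => (φ.commutes k).symm
  exact ⟨IsRationalExt.trans, IsStablyRationalExt.trans, IsRetractRationalExt.trans⟩

end BaseChange

section Product

variable (K H G : Type*) [Field K] [Group H] [Group G] [Fintype H] [Fintype G]
  [DecidableEq H] [DecidableEq G]

/-- Only the rational case requires `Z` to be nonempty. This holds for `H` and `G` nontrivial, and
for trivial `H` the embedding is an isomorphism. -/
theorem isRationalExt_prod_of_snd :
    letI : Algebra (NoetherField K G) (NoetherField K (H × G)) :=
      (noetherFieldMap (K := K) (MonoidHom.snd_surjective H G)).toRingHom.toAlgebra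
    (Nontrivial G → IsRationalExt K (NoetherField K H) →
      IsRationalExt (NoetherField K G) (NoetherField K (H × G))) ∧
    (IsStablyRationalExt K (NoetherField K H) →
      IsStablyRationalExt (NoetherField K G) (NoetherField K (H × G))) ∧
    (IsRetractRationalExt K (NoetherField K H) →
      IsRetractRationalExt (NoetherField K G) (NoetherField K (H × G))) := by
  obtain ⟨Z, hZfin, hZ, hb⟩ := exists_isPureBasis_invariants K H G
  have hcard := hb.trdeg_eq
  rw [(RatFunField.isPureBasis_x K (H × G)).trdeg_eq, Nat.cast_inj, Nat.card_sum,
    Nat.card_sum] at hcard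
  have key := isRationalExt_of_algHom (noetherFieldMap (K := K) (MonoidHom.snd_surjective H G))
    (noetherFieldMap (K := K) (MonoidHom.fst_surjective H G)) (projNoetherField K H)
    isPureBasis_varSum (M := RatFunField K (H × G)) (z := fun z : Z => ⟨z.1, hZ z.1 z.2⟩) hb.1
    (fun a ha => by
      have h : (projField K H).map (fiberSumFst K H G) ≤ IntermediateField.adjoin K
          (Set.range fun h : {h : H // h ≠ 1} => fiberSumFst K H G (projVar K h.1)) := by
        rw [projField_eq_adjoin, IntermediateField.adjoin_map, ← Set.range_comp]
        rfl
      exact h ⟨_, ha, rfl⟩)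
    (fun a => IntermediateField.map_mem_adjoin_of_adjoin_eq_top (RatFunField.isPureBasis_x K G).2
      (fiberSumSnd K H G) _
      (by rintro _ ⟨g, rfl⟩; exact IntermediateField.subset_adjoin _ _ ⟨g, rfl⟩) a.1)
    (fun B hB₁ hB₂ hB₃ => by
      have hB : ∀ b : NoetherField K (H × G), b ∈ B →
        (b : RatFunField K (H × G)) ∈ B.map (NoetherField K (H × G)).val := fun b hb => ⟨b, hb, rfl⟩
      have h : NoetherField K (H × G) ≤ B.map (NoetherField K (H × G)).val := by
        refine (noetherField_prod_le_adjoin hZ hb).trans (IntermediateField.adjoin_le_iff.2 ?_)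
        rintro _ ((⟨a, ha, rfl⟩ | ⟨b, hb, rfl⟩) | hz)
        exacts [hB _ (hB₁ ⟨a, ha.2⟩ ha.1), hB _ (hB₂ ⟨b, hb⟩), hB _ (hB₃ ⟨_, hz⟩)]
      refine eq_top_iff.2 fun a _ => ?_
      obtain ⟨b, hb, hba⟩ := h a.2
      rwa [← Subtype.ext hba])
    trdeg_noetherField trdeg_projNoetherField (by
      rw [trdeg_noetherField, hcard]
      congr 1
      ring)
  refine ⟨fun hG h => ?_, key.2⟩
  rcases subsingleton_or_nontrivial H with hH | hH
  · exact @IsRationalExt.of_surjective _ _ _ _ (AlgHom.toRingHom _).toAlgebra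
      (noetherFieldMap_surjective _ fun p q hpq => Prod.ext (Subsingleton.elim _ _) hpq)
  -- An empty `Z` would give |H||G| = |G| + |H| - 1, that is (|H|-1)(|G|-1) = 0.
  · refine key.1 (Finite.card_pos_iff.1 (Nat.pos_of_ne_zero fun h0 => ?_)) h
    have h1 := card_ne_one_add_one (H := H)
    have h2 := Finite.one_lt_card (α := H)
    have h3 := Finite.one_lt_card (α := G)
    rw [Nat.card_prod, h0] at hcard
    nlinarith

theorem exists_algHom_isRationalExt_prod :
    ∃ φ : NoetherField K G →ₐ[K] NoetherField K (H × G),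
      letI : Algebra (NoetherField K G) (NoetherField K (H × G)) := φ.toRingHom.toAlgebra
      (IsRationalExt K (NoetherField K H) →
        IsRationalExt (NoetherField K G) (NoetherField K (H × G))) ∧
      (IsStablyRationalExt K (NoetherField K H) →
        IsStablyRationalExt (NoetherField K G) (NoetherField K (H × G))) ∧
      (IsRetractRationalExt K (NoetherField K H) →
        IsRetractRationalExt (NoetherField K G) (NoetherField K (H × G))) := by
  have hsnd := isRationalExt_prod_of_snd K H G
  rcases subsingleton_or_nontrivial G with hG | hG
  -- For trivial `G` there is no `z` to replace `s`. If K(H) is rational, the single variable of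
  -- K(G) is sent to a basis element instead, and rationality over K(G) implies the other two
  -- properties. If not, the rational claim is vacuous and the embedding by fibre sums serves.
  · by_cases hH : IsRationalExt K (NoetherField K H)
    · let e := AlgEquiv.ofBijective (noetherFieldMap (K := K) (MonoidHom.fst_surjective H G))
        ⟨RingHom.injective _, noetherFieldMap_surjective _ fun p q hpq =>
          Prod.ext hpq (Subsingleton.elim _ _)⟩
      obtain ⟨s, hs⟩ := exists_isPureBasis_noetherField K G
      let _ : Unique G := ⟨⟨1⟩, fun g => Subsingleton.elim g 1⟩
      obtain ⟨φ, hφ⟩ := exists_algHom_isRationalExt hs (hH.of_algEquiv e) (by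
        rw [trdeg_noetherField, Ne, Nat.cast_eq_zero]
        exact Nat.card_pos.ne')
      let _ : Algebra (NoetherField K G) (NoetherField K (H × G)) := φ.toRingHom.toAlgebra
      have hφ : IsRationalExt (NoetherField K G) (NoetherField K (H × G)) := hφ
      exact ⟨φ, fun _ => hφ, fun _ => hφ.isStablyRationalExt, fun _ => hφ.isRetractRationalExt⟩
    · exact ⟨_, fun h => (hH h).elim, hsnd.2.1, hsnd.2.2⟩
  · exact ⟨_, hsnd.1 hG, hsnd.2.1, hsnd.2.2⟩

end Product

end

theorem theorem1p9 {K H G : Type*} [Field K] [Group H] [Group G] [Finite H] [Finite G] :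
    -- a single embedding of `K(G)` into `K(H × G)` serves all three properties
    (∃ φ : NoetherField K G →ₐ[K] NoetherField K (H × G),
      letI : Algebra (NoetherField K G) (NoetherField K (H × G)) := φ.toRingHom.toAlgebra
      (IsRationalExt K (NoetherField K H) →
        IsRationalExt (NoetherField K G) (NoetherField K (H × G))) ∧
      (IsStablyRationalExt K (NoetherField K H) →
        IsStablyRationalExt (NoetherField K G) (NoetherField K (H × G))) ∧
      (IsRetractRationalExt K (NoetherField K H) →
        IsRetractRationalExt (NoetherField K G) (NoetherField K (H × G)))) ∧
    (IsRationalExt K (NoetherField K H) → IsRationalExt K (NoetherField K G) →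
      IsRationalExt K (NoetherField K (H × G))) ∧
    (IsStablyRationalExt K (NoetherField K H) → IsStablyRationalExt K (NoetherField K G) →
      IsStablyRationalExt K (NoetherField K (H × G))) ∧
    (IsRetractRationalExt K (NoetherField K H) → IsRetractRationalExt K (NoetherField K G) →
      IsRetractRationalExt K (NoetherField K (H × G))) := by
  classical
  have := Fintype.ofFinite H
  have := Fintype.ofFinite G
  obtain ⟨φ, h₁, h₂, h₃⟩ := exists_algHom_isRationalExt_prod K H G
  refine ⟨⟨φ, h₁, h₂, h₃⟩, ?_⟩
  have h := isRationalExt_trans_of_algHom φ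
  exact ⟨fun hH hG => h.1 hG (h₁ hH), fun hH hG => h.2.1 hG (h₂ hH),
    fun hH hG => h.2.2 hG (h₃ hH)⟩
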